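/- There exists a $C^\infty$ diffeomorphism $f$ of $\mathbb{R}^4$ (with its standard Euclidean structure) with the following properties. (1) The support of $f$, i.e. the closure of $\{x : f(x)\neq x\}$, is compact. (2) There are compact sets $B\subset A\subset\mathbb{R}^4$ with $f(A)\subset\mathrm{int}(A)$ and $f(B)\subset\mathrm{int}(B)$. (3) There are two hyperbolic fixed points $P,Q$ of $f$ in $C:=A\setminus B$. (4) $f$ has a heterodimensional cycle associated to $P$ and $Q$: their indices differ, $W^s(P)\cap W^u(Q)\neq\emptyset$ and $W^s(Q)\cap W^u(P)\neq\emptyset$, where the index of a hyperbolic fixed point is the dimension of its unstable manifold, that is, the number of eigenvalues (with multiplicity) of the derivative of modulus greater than $1$. (5) $P$ has index $3$, and if $\sigma,\mu_1,\mu_2,\mu_3$ are the eigenvalues of $df(P)$, listed with multiplicity in non-decreasing order of their absolute values, then $\mu_1,\mu_2\in\mathbb{C}\setminus\mathbb{R}$. (6) $Q$ has index $2$, and every eigenvalue of $df(Q)$ is in $\mathbb{C}\setminus\mathbb{R}$. (7) There is a constant $K>1$ such that $m(\Lambda^3(df(x)))>K$ for all $x\in C$, where $\Lambda^3(df(x))$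 is the map induced by $df(x)$ on $\Lambda^3\mathbb{R}^4$ with the norm induced from the standard inner product, and $m(L)$ is the minimum of $\|Lv\|$ over unit vectors $v$; in other words, $df(x)$ expands the volume of every three-dimensional subspace by a factor greater than $K$. -/

import Mathlib

open Filter Topology
open scoped Manifold ContDiff

namespace CycleDyn

/-- Four-dimensional Euclidean space with its standard inner product. -/
abbrev R4 : Type := EuclideanSpace ℝ (Fin 4)

/-- The group of `C^∞` diffeomorphisms of `ℝ⁴` (as a type). -/
abbrev DiffR4 : Type := Diffeomorph 𝓘(ℝ, R4) 𝓘(ℝ, R4) R4 R4 ∞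

/-- The support of a self-map: the closure of the set of points that it moves. -/
def support (f : R4 → R4) : Set R4 := closure {x | f x ≠ x}

/-- The multiset of the four complex eigenvalues of the derivative `df(x)`, each repeated
according to its algebraic multiplicity. -/
noncomputable def eigenvalues (f : R4 → R4) (x : R4) : Multiset ℂ :=
  ((fderiv ℝ f x).toLinearMap.charpoly).aroots ℂ

/-- `P` is a hyperbolic fixed point of `f`: it is fixed, and `df(P)` has no eigenvalue of
modulus one. -/
def IsHyperbolicFixedPoint (f : R4 → R4) (P : R4) : Prop :=
  f P = P ∧ ∀ μ ∈ eigenvalues f P, ‖μ‖ ≠ 1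

open Classical in
/-- The index of a hyperbolic fixed point: the dimension of its unstable manifold, that is, the
number of eigenvalues of `df(P)` of modulus greater than one, counted with multiplicity. -/
noncomputable def index (f : R4 → R4) (P : R4) : ℕ :=
  (eigenvalues f P).countP fun μ => 1 < ‖μ‖

/-- The stable manifold of a fixed point `P`. -/
def stableManifold (f : DiffR4) (P : R4) : Set R4 :=
  {x | Tendsto (fun n : ℕ => f^[n] x) atTop (𝓝 P)}

/-- The unstable manifold of a fixed point `P`: the stable manifold for the inverse of `f`. -/
def unstableManifold (f : DiffR4) (P : R4) : Set R4 :=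
  stableManifold f.symm P

/-- `f` has a heterodimensional cycle associated to the hyperbolic fixed points `P` and `Q`: the
indices differ, and the stable manifold of each point meets the unstable manifold of the other. -/
def HasHeterodimensionalCycle (f : DiffR4) (P Q : R4) : Prop :=
  IsHyperbolicFixedPoint f P ∧ IsHyperbolicFixedPoint f Q ∧
    index f P ≠ index f Q ∧
    (stableManifold f P ∩ unstableManifold f Q).Nonempty ∧
    (stableManifold f Q ∩ unstableManifold f P).Nonempty

/-- `m(L)`, the minimum of `‖L v‖` over all unit vectors `v`. -/
noncomputable def minNorm {V W : Type*} [NormedAddCommGroup V] [NormedSpace ℝ V]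
    [NormedAddCommGroup W] [NormedSpace ℝ W] (L : V →ₗ[ℝ] W) : ℝ :=
  sInf ((fun v => ‖L v‖) '' Metric.sphere (0 : V) 1)

/-- `Λ³(df)(x)`, the map that `df(x)` induces on the third exterior power of `ℝ⁴`. The exterior
power carries the norm induced from the standard inner product of `ℝ⁴` (Gram determinants). -/
noncomputable def exteriorCubeDeriv (f : R4 → R4) (x : R4) : ⋀[ℝ]^3 R4 →ₗ[ℝ] ⋀[ℝ]^3 R4 :=
  exteriorPower.map 3 (fderiv ℝ f x).toLinearMap

end CycleDyn

open CycleDyn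

/-! The example is a two-branch horseshoe in the coordinates `x 0`, `x 1`, coupled to a different
linear type on `x 2`, `x 3` over each branch. Over the thin strips around `x 0 = 0` and `x 0 = 3`,
the first two coordinates undergo a quarter turn and expansion by 512, which gives the eigenvalues
`±512i` at both fixed points. The last two undergo a spiral sink over the left strip (`spiralPt`,
index 2) and a saddle over the right one (`saddlePt`, index 3), whose unstable direction is an
`arctan` so that its image stays bounded.

Cycle: each unstable manifold contains a large square in the first two coordinates at `x 3 = 0`, `x
2 = ∓1/2`, and each stable manifold contains a fibre in the `x 2` direction long enough to cross
both squares.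

Filtration: `A` is a box and `B` is `A` minus the strips. `expand` is bounded on the relevant range,
so `A` is trapped; it has modulus at least 4 off `|x| < 1/128`, so points of `B` land far from the
strips. Between the strips, where `twist` varies, `push` displaces `x 1` to force the same escape.

Volume: if `M` is the action on the last two coordinates, the third exterior power of the derivative
is `512 ^ 2` times `M` plus `512 * det M` times a quarter turn. Since `det M ≥ 1/256` on both
branches, every 3-volume grows by at least 2.

Smoothness and compact support: `model` is a composition of maps that each change one coordinate
monotonically, and such a map can be cut off outside a ball while remaining a diffeomorphism
(`realizable_elem`, `Realizable.comp`). For this reason the recentring `fold` reads the new third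
coordinate, which already separates the branches, instead of `x 0`. -/

namespace CycleDyn

/-! ### A smooth clamp -/

/-- The bump function on the line that is the derivative of `clamp 1`. -/
noncomputable def clampBump : ContDiffBump (0 : ℝ) := ⟨1, 2, one_pos, one_lt_two⟩

/-- A smooth monotone bounded function that is the identity on `[-r, r]`. -/
noncomputable def clamp (r : ℝ) (x : ℝ) : ℝ :=
  ∫ t in (0 : ℝ)..x, clampBump (t / r)

theorem continuous_clampBump_div (r : ℝ) : Continuous fun t => clampBump (t / r) :=
  clampBump.continuous.comp (continuous_id.div_const r)

theorem hasDerivAt_clamp (r x : ℝ) : HasDerivAt (clamp r) (clampBump (x / r)) x :=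
  intervalIntegral.integral_hasDerivAt_right
    ((continuous_clampBump_div r).intervalIntegrable _ _)
    ((continuous_clampBump_div r).stronglyMeasurableAtFilter _ _)
    (continuous_clampBump_div r).continuousAt

theorem contDiff_clamp (r : ℝ) : ContDiff ℝ ∞ (clamp r) := by
  rw [contDiff_infty_iff_deriv]
  refine ⟨fun x => (hasDerivAt_clamp r x).differentiableAt, ?_⟩
  rw [show deriv (clamp r) = fun x => clampBump (x / r) from
    funext fun x => (hasDerivAt_clamp r x).deriv]
  exact clampBump.contDiff.comp (contDiff_id.div_const r)

theorem clamp_monotone (r : ℝ) : Monotone (clamp r) :=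
  monotone_of_hasDerivAt_nonneg (hasDerivAt_clamp r) fun _ => clampBump.nonneg

theorem clamp_of_abs_le {r x : ℝ} (hr : 0 < r) (hx : |x| ≤ r) : clamp r x = x := by
  have : clamp r x = ∫ _ in (0 : ℝ)..x, (1 : ℝ) := by
    refine intervalIntegral.integral_congr fun t ht => ?_
    refine clampBump.one_of_mem_closedBall ?_
    have : |t| ≤ |x| := by
      have := Set.abs_sub_left_of_mem_uIcc ht
      simpa using this
    rw [mem_closedBall_zero_iff, Real.norm_eq_abs, abs_div, abs_of_pos hr]
    exact (div_le_one hr).2 (this.trans hx)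
  simpa using this

theorem clamp_neg (r x : ℝ) : clamp r (-x) = -clamp r x := by
  have h : ∀ t, clampBump (-t / r) = clampBump (t / r) := fun t => by
    rw [neg_div]; exact clampBump.neg _
  calc clamp r (-x) = ∫ t in (0 : ℝ)..(-x), clampBump (-t / r) := by simp_rw [h]; rfl
    _ = ∫ t in x..(0 : ℝ), clampBump (t / r) := by
      rw [intervalIntegral.integral_comp_neg fun t => clampBump (t / r)]; simp
    _ = -clamp r x := intervalIntegral.integral_symm _ _

theorem le_clamp {r x : ℝ} (hr : 0 < r) (hx : r ≤ x) : r ≤ clamp r x := by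
  simpa [clamp_of_abs_le hr (abs_of_pos hr).le] using clamp_monotone r hx

/-- The integrand is at most 1 and vanishes beyond `2 * r`. -/
theorem clamp_le {r : ℝ} (hr : 0 < r) (x : ℝ) : clamp r x ≤ 2 * r := by
  have h0 : ∀ y, 0 ≤ y → clamp r y ≤ y := fun y hy => by
    have : clamp r y ≤ ∫ _ in (0 : ℝ)..y, (1 : ℝ) :=
      intervalIntegral.integral_mono_on hy ((continuous_clampBump_div r).intervalIntegrable _ _)
        (by simp) fun t _ => clampBump.le_one
    simpa using this
  rcases le_total x (2 * r) with h | h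
  · exact (clamp_monotone r h).trans (h0 _ (by positivity))
  · have h1 : clamp r x = clamp r (2 * r) + ∫ t in (2 * r)..x, clampBump (t / r) :=
      (intervalIntegral.integral_add_adjacent_intervals
        ((continuous_clampBump_div r).intervalIntegrable _ _)
        ((continuous_clampBump_div r).intervalIntegrable _ _)).symm
    have h2 : ∫ t in (2 * r)..x, clampBump (t / r) = ∫ _ in (2 * r)..x, (0 : ℝ) := by
      refine intervalIntegral.integral_congr fun t ht => ?_
      rw [Set.uIcc_of_le h] at ht
      refine clampBump.zero_of_le_dist ?_
      rw [dist_zero_right, Real.norm_eq_abs]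
      exact le_trans ((le_div_iff₀ hr).2 ht.1) (le_abs_self _)
    rw [h1, h2]
    simpa using h0 (2 * r) (by positivity)

theorem abs_clamp_le {r : ℝ} (hr : 0 < r) (x : ℝ) : |clamp r x| ≤ 2 * r :=
  abs_le.2 ⟨by have := clamp_le hr (-x); rw [clamp_neg] at this; linarith, clamp_le hr x⟩

/-! ### Elementary diffeomorphisms -/

/-- The `i`-th standard basis vector. -/
noncomputable abbrev stdVec (i : Fin 4) : R4 := EuclideanSpace.single i 1

/-- The map that adds `G` to the `i`-th coordinate. -/
noncomputable def elem (i : Fin 4) (G : R4 → ℝ) (x : R4) : R4 := x + G x • stdVec i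

theorem elem_apply_self (i : Fin 4) (G : R4 → ℝ) (x : R4) : elem i G x i = x i + G x := by
  simp [elem]

theorem elem_apply_ne {i j : Fin 4} (h : j ≠ i) (G : R4 → ℝ) (x : R4) : elem i G x j = x j := by
  simp [elem, h]

theorem contDiff_elem (i : Fin 4) {G : R4 → ℝ} (hG : ContDiff ℝ ∞ G) : ContDiff ℝ ∞ (elem i G) :=
  contDiff_id.add (hG.smul contDiff_const)

theorem hasDerivAt_line (i : Fin 4) {G : R4 → ℝ} (hG : ContDiff ℝ ∞ G) (x : R4) (t : ℝ) :
    HasDerivAt (fun t : ℝ => G (x + t • stdVec i))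
      (fderiv ℝ G (x + t • stdVec i) (stdVec i)) t := by
  have h1 : HasDerivAt (fun t : ℝ => x + t • stdVec i) (stdVec i) t := by
    simpa using ((hasDerivAt_id t).smul_const (stdVec i)).const_add x
  exact ((hG.differentiable (by simp)) _).hasFDerivAt.comp_hasDerivAt t h1

theorem strictMono_elem_line {i : Fin 4} {G : R4 → ℝ} (hG : ContDiff ℝ ∞ G)
    (hd : ∀ x, -1 < fderiv ℝ G x (stdVec i)) (x : R4) :
    StrictMono fun t : ℝ => t + G (x + t • stdVec i) := by
  refine strictMono_of_hasDerivAt_pos (f' := fun t => 1 + fderiv ℝ G (x + t • stdVec i) (stdVec i))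
    (fun t => (hasDerivAt_id t).add (hasDerivAt_line i hG x t)) fun t => ?_
  linarith [hd (x + t • stdVec i)]

/-- Points with the same image lie on one line parallel to the `i`-th axis, and the map is strictly
increasing along it. -/
theorem elem_injective {i : Fin 4} {G : R4 → ℝ} (hG : ContDiff ℝ ∞ G)
    (hd : ∀ x, -1 < fderiv ℝ G x (stdVec i)) : Function.Injective (elem i G) := by
  intro x y h
  obtain ⟨t, ht⟩ : ∃ t : ℝ, y = x + t • stdVec i := by
    refine ⟨G x - G y, ?_⟩
    have : x + G x • stdVec i = y + G y • stdVec i := h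
    rw [sub_smul, ← add_sub_assoc, this, add_sub_cancel_right]
  have h2 := congrArg (fun z : R4 => z i) h
  simp only [elem_apply_self] at h2
  have : (0 : ℝ) = t := by
    refine (strictMono_elem_line hG hd x).injective ?_
    have h3 : y i = x i + t := by simp [ht]
    simp only [zero_smul, add_zero, ← ht]
    linarith
  simp [ht, ← this]

/-- Intermediate value theorem on the line through `y` parallel to the `i`-th axis. -/
theorem elem_surjective {i : Fin 4} {G : R4 → ℝ} (hG : ContDiff ℝ ∞ G)
    {M : ℝ} (hM : ∀ x, |G x| ≤ M) : Function.Surjective (elem i G) := by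
  intro y
  have hc : Continuous fun t : ℝ => t + G (y + t • stdVec i) :=
    continuous_id.add (hG.continuous.comp (by fun_prop))
  obtain ⟨t, ht⟩ : ∃ t : ℝ, t + G (y + t • stdVec i) = 0 := by
    refine mem_range_of_exists_le_of_exists_ge hc ⟨-M, ?_⟩ ⟨M, ?_⟩
    · linarith [(abs_le.1 (hM (y + (-M) • stdVec i))).2]
    · linarith [(abs_le.1 (hM (y + M • stdVec i))).1]
  refine ⟨y + t • stdVec i, ?_⟩
  rw [elem, add_assoc, ← add_smul, ht, zero_smul, add_zero]

/-- The derivative of an elementary map, as an equivalence. -/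
theorem exists_fderiv_elem_equiv {i : Fin 4} {G : R4 → ℝ} (hG : ContDiff ℝ ∞ G)
    (hd : ∀ x, -1 < fderiv ℝ G x (stdVec i)) (x : R4) :
    ∃ e : R4 ≃L[ℝ] R4, HasFDerivAt (elem i G) (e : R4 →L[ℝ] R4) x := by
  set L := fderiv ℝ G x with hL
  have hne : 1 + L (stdVec i) ≠ 0 := by linarith [hd x]
  have h : HasFDerivAt (elem i G) (ContinuousLinearMap.id ℝ R4 + L.smulRight (stdVec i)) x :=
    (hasFDerivAt_id x).add
      (((hG.differentiable (by simp)) x).hasFDerivAt.smul_const (stdVec i))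
  -- The derivative is a rank-one perturbation of the identity; the Sherman–Morrison formula inverts
  -- it.
  refine ⟨ContinuousLinearEquiv.equivOfInverse
    (ContinuousLinearMap.id ℝ R4 + L.smulRight (stdVec i))
    (ContinuousLinearMap.id ℝ R4 - ((1 + L (stdVec i))⁻¹ • L).smulRight (stdVec i)) ?_ ?_, h⟩
  · intro v
    simp only [_root_.add_apply, _root_.sub_apply,
      ContinuousLinearMap.id_apply, ContinuousLinearMap.smulRight_apply,
      _root_.smul_apply, map_add, map_smul, smul_eq_mul]
    have : (1 + L (stdVec i))⁻¹ * (L v + L v * L (stdVec i)) = L v := by field_simp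
    linear_combination (norm := module) (-this) • stdVec i
  · intro v
    simp only [_root_.add_apply, _root_.sub_apply,
      ContinuousLinearMap.id_apply, ContinuousLinearMap.smulRight_apply,
      _root_.smul_apply, map_sub, map_smul, smul_eq_mul]
    have : L v - (1 + L (stdVec i))⁻¹ * L v * L (stdVec i) = (1 + L (stdVec i))⁻¹ * L v := by
      field_simp; ring
    linear_combination (norm := module) this • stdVec i

/-- An elementary map with bounded displacement is a diffeomorphism. -/
theorem exists_diffeo_elem {i : Fin 4} {G : R4 → ℝ} (hG : ContDiff ℝ ∞ G)
    (hd : ∀ x, -1 < fderiv ℝ G x (stdVec i)) {M : ℝ} (hM : ∀ x, |G x| ≤ M) :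
    ∃ F : DiffR4, ∀ x, F x = elem i G x := by
  set e := Equiv.ofBijective (elem i G) ⟨elem_injective hG hd, elem_surjective hG hM⟩ with he
  have hs : ContDiff ℝ ∞ e.symm := by
    rw [contDiff_iff_contDiffAt]
    intro y
    obtain ⟨x, rfl⟩ := e.surjective y
    obtain ⟨L, hL⟩ := exists_fderiv_elem_equiv hG hd x
    have hf : ContDiffAt ℝ ∞ (elem i G) x := (contDiff_elem i hG).contDiffAt
    have hstrict := hf.hasStrictFDerivAt' hL (by simp)
    -- By injectivity, the global inverse agrees near `elem i G x` with the smooth local inverse of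
    -- the inverse function theorem.
    refine (hf.to_localInverse hL (by simp)).congr_of_eventuallyEq ?_
    filter_upwards [hstrict.eventually_right_inverse] with z hz
    rw [Equiv.symm_apply_eq]
    exact hz.symm
  exact ⟨⟨e, (contDiff_elem i hG).contMDiff, hs.contMDiff⟩, fun x => rfl⟩

/-! ### Maps that agree on balls with compactly supported diffeomorphisms -/

/-- On every ball, `f` agrees with a compactly supported diffeomorphism. -/
def Realizable (f : R4 → R4) : Prop :=
  ∀ R : ℝ, ∃ F : DiffR4, IsCompact (support F) ∧ ∀ x, ‖x‖ ≤ R → F x = f x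

theorem Realizable.comp {f g : R4 → R4} (hf : Realizable f) (hg : Realizable g)
    (hc : Continuous g) : Realizable (f ∘ g) := by
  intro R
  obtain ⟨G, hG, hGg⟩ := hg R
  obtain ⟨R', hR'⟩ : ∃ R', ∀ x, ‖x‖ ≤ R → ‖g x‖ ≤ R' := by
    obtain ⟨R', h⟩ := ((isCompact_closedBall (0 : R4) R).image hc).isBounded.exists_norm_le
    exact ⟨R', fun x hx => h _ ⟨x, by simpa using hx, rfl⟩⟩
  obtain ⟨F, hF, hFf⟩ := hf R'
  refine ⟨G.trans F, ?_, fun x hx => ?_⟩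
  · refine (hG.union hF).of_isClosed_subset isClosed_closure ?_
    refine closure_minimal (fun x hx => ?_) (hG.isClosed.union hF.isClosed)
    by_cases h : G x = x
    · refine Or.inr (subset_closure ?_)
      simpa [h] using hx
    · exact Or.inl (subset_closure h)
  · simp [hGg x hx, hFf _ (hR' x hx)]

/-- Clamping every coordinate. -/
noncomputable def clampMap (r : ℝ) (x : R4) : R4 := WithLp.toLp 2 fun j => clamp r (x j)

theorem contDiff_clampMap (r : ℝ) : ContDiff ℝ ∞ (clampMap r) := by
  rw [contDiff_euclidean]
  exact fun j => (contDiff_clamp r).comp (contDiff_piLp_apply 2)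

/-- Precomposition with `clampMap` thus multiplies the `i`-th partial derivative by a factor in `[0,
1]`, which preserves any lower bound `-c` with `c ≥ 0`. -/
theorem fderiv_clampMap_stdVec (r : ℝ) (i : Fin 4) (x : R4) :
    fderiv ℝ (clampMap r) x (stdVec i) = clampBump (x i / r) • stdVec i := by
  have hd : DifferentiableAt ℝ (clampMap r) x := (contDiff_clampMap r).differentiable (by simp) x
  ext j
  have h1 : HasFDerivAt (fun y => clampMap r y j)
      ((EuclideanSpace.proj j : R4 →L[ℝ] ℝ).comp (fderiv ℝ (clampMap r) x)) x :=
    (EuclideanSpace.proj j : R4 →L[ℝ] ℝ).hasFDerivAt.comp x hd.hasFDerivAt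
  have h2 : HasFDerivAt (fun y : R4 => clamp r (y j))
      (clampBump (x j / r) • (EuclideanSpace.proj j : R4 →L[ℝ] ℝ)) x :=
    HasDerivAt.comp_hasFDerivAt (f := fun y : R4 => y j) x (hasDerivAt_clamp r (x j))
      (EuclideanSpace.proj j : R4 →L[ℝ] ℝ).hasFDerivAt
  have h3 := congrArg (fun L : R4 →L[ℝ] ℝ => L (stdVec i)) (h1.unique h2)
  have h4 : fderiv ℝ (clampMap r) x (stdVec i) j
      = clampBump (x j / r) * (stdVec i : R4) j := h3
  rw [h4]
  by_cases hij : j = i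
  · subst hij; simp
  · simp [hij]

theorem clampMap_of_norm_le {r : ℝ} (hr : 0 < r) {x : R4} (hx : ‖x‖ ≤ r) : clampMap r x = x := by
  ext j
  exact clamp_of_abs_le hr ((PiLp.norm_apply_le x j).trans hx)

theorem exists_bound_comp_clampMap {G : R4 → ℝ} (hG : Continuous G) {r : ℝ} (hr : 0 < r) :
    ∃ M, 0 < M ∧ ∀ x, |G (clampMap r x)| ≤ M := by
  have hK : IsCompact (WithLp.toLp 2 '' Set.Icc (fun _ : Fin 4 => -(2 * r)) fun _ => 2 * r) :=
    isCompact_Icc.image (PiLp.continuous_toLp 2 _)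
  obtain ⟨M, hM⟩ := (hK.image hG).isBounded.exists_norm_le
  refine ⟨max M 1, by positivity, fun x => le_max_of_le_left (hM _ ⟨_, ⟨_, ⟨?_, ?_⟩, rfl⟩, rfl⟩)⟩
  · exact fun j => (abs_le.1 (abs_clamp_le hr _)).1
  · exact fun j => (abs_le.1 (abs_clamp_le hr _)).2

/-- Wide bump functions have small derivative. -/
theorem exists_wide_bump (R : ℝ) {ε : ℝ} (hε : 0 < ε) :
    ∃ χ : R4 → ℝ, ContDiff ℝ ∞ χ ∧ HasCompactSupport χ ∧ (∀ x, 0 ≤ χ x) ∧ (∀ x, χ x ≤ 1) ∧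
      (∀ x, ‖x‖ ≤ R → χ x = 1) ∧ ∀ x (i : Fin 4), |fderiv ℝ χ x (stdVec i)| ≤ ε := by
  set β : ContDiffBump (0 : R4) := ⟨1, 2, one_pos, one_lt_two⟩ with hβ
  have hβc : ContDiff ℝ ∞ β := β.contDiff
  obtain ⟨C, hC⟩ := (β.hasCompactSupport.fderiv (𝕜 := ℝ)).exists_bound_of_continuous
    (hβc.continuous_fderiv (by simp))
  -- Dilation by `ρ` divides the derivative bound `C` by `ρ`.
  obtain ⟨ρ, hρ⟩ : ∃ ρ : ℝ, ρ = max (max 1 R) (C / ε) := ⟨_, rfl⟩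
  have h1 : 1 ≤ ρ := hρ ▸ (le_max_left _ _).trans (le_max_left _ _)
  have hR : R ≤ ρ := hρ ▸ (le_max_right _ _).trans (le_max_left _ _)
  have hCε : C / ε ≤ ρ := hρ ▸ le_max_right _ _
  have hρ0 : 0 < ρ := by linarith
  have hderiv : ∀ x, HasFDerivAt (fun x => β (ρ⁻¹ • x))
      ((fderiv ℝ β (ρ⁻¹ • x)).comp (ρ⁻¹ • ContinuousLinearMap.id ℝ R4)) x := fun x =>
    ((hβc.differentiable (by simp)) _).hasFDerivAt.comp x ((hasFDerivAt_id x).const_smul ρ⁻¹)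
  refine ⟨fun x => β (ρ⁻¹ • x), hβc.comp (contDiff_const_smul _), ?_, fun x => β.nonneg,
    fun x => β.le_one, fun x hx => ?_, fun x i => ?_⟩
  · exact β.hasCompactSupport.comp_smul (inv_ne_zero hρ0.ne')
  · refine β.one_of_mem_closedBall ?_
    rw [mem_closedBall_zero_iff, norm_smul, norm_inv, Real.norm_of_nonneg hρ0.le]
    rw [inv_mul_le_iff₀ hρ0]
    exact (hx.trans hR).trans (mul_one ρ).ge
  · rw [(hderiv x).fderiv]
    have h2 : ‖fderiv ℝ β (ρ⁻¹ • x) (stdVec i)‖ ≤ C := by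
      simpa using (fderiv ℝ β (ρ⁻¹ • x)).le_of_opNorm_le (hC _) (stdVec i)
    rw [ContinuousLinearMap.comp_apply, _root_.smul_apply,
      ContinuousLinearMap.id_apply, map_smul, smul_eq_mul, abs_mul, abs_inv, abs_of_pos hρ0,
      inv_mul_le_iff₀ hρ0]
    rw [div_le_iff₀ hε] at hCε
    exact h2.trans hCε

/-- A plain cutoff `χ * G` could spoil the derivative bound, because `G` may grow as fast as `χ`
flattens. Clamping the argument first makes `G` bounded by `M` independently of `χ`; then `χ` is
taken so wide that the term `G * ∂χ` costs at most `(1 - c) / 2`, and the derivative stays above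
`-1`. -/
theorem realizable_elem (i : Fin 4) {G : R4 → ℝ} (hG : ContDiff ℝ ∞ G) {c : ℝ} (hc0 : 0 ≤ c)
    (hc : c < 1) (hd : ∀ x, -c ≤ fderiv ℝ G x (stdVec i)) : Realizable (elem i G) := by
  intro R
  obtain ⟨r, hr⟩ : ∃ r : ℝ, r = max 1 R := ⟨_, rfl⟩
  have hr0 : 0 < r := hr ▸ lt_of_lt_of_le one_pos (le_max_left _ _)
  obtain ⟨M, hM0, hM⟩ := exists_bound_comp_clampMap hG.continuous hr0
  obtain ⟨χ, hχ, hχc, hχ0, hχ1, hχR, hχd⟩ :=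
    exists_wide_bump R (div_pos (sub_pos.2 hc) (mul_pos two_pos hM0))
  have hGc : ContDiff ℝ ∞ fun x => G (clampMap r x) := hG.comp (contDiff_clampMap r)
  have hdc : ∀ x, -c ≤ fderiv ℝ (fun x => G (clampMap r x)) x (stdVec i) := by
    intro x
    have h := ((hG.differentiable (by simp)) (clampMap r x)).hasFDerivAt.comp x
      (((contDiff_clampMap r).differentiable (by simp)) x).hasFDerivAt
    have h' : fderiv ℝ (fun x => G (clampMap r x)) x = _ := h.fderiv
    rw [h', ContinuousLinearMap.comp_apply, fderiv_clampMap_stdVec, map_smul, smul_eq_mul]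
    have h0 : 0 ≤ clampBump (x i / r) := clampBump.nonneg
    have h1 : clampBump (x i / r) ≤ 1 := clampBump.le_one
    nlinarith [hd (clampMap r x)]
  set H : R4 → ℝ := fun x => χ x * G (clampMap r x) with hH
  have hHs : ContDiff ℝ ∞ H := hχ.mul hGc
  have hHd : ∀ x, -1 < fderiv ℝ H x (stdVec i) := by
    intro x
    have h := ((hχ.differentiable (by simp)) x).hasFDerivAt.mul
      ((hGc.differentiable (by simp)) x).hasFDerivAt
    have h' : fderiv ℝ H x = _ := h.fderiv
    rw [h', _root_.add_apply, _root_.smul_apply,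
      _root_.smul_apply, smul_eq_mul, smul_eq_mul]
    have h1 : -c ≤ χ x * fderiv ℝ (fun x => G (clampMap r x)) x (stdVec i) := by
      nlinarith [hdc x, hχ0 x, hχ1 x]
    have h2 : |G (clampMap r x) * fderiv ℝ χ x (stdVec i)| ≤ (1 - c) / 2 := by
      rw [abs_mul]
      calc _ ≤ M * ((1 - c) / (2 * M)) :=
            mul_le_mul (hM x) (hχd x i) (abs_nonneg _) hM0.le
        _ = (1 - c) / 2 := by field_simp
    linarith [(abs_le.1 h2).1]
  have hHM : ∀ x, |H x| ≤ M := fun x => by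
    rw [abs_mul, abs_of_nonneg (hχ0 x)]
    exact (mul_le_of_le_one_left (abs_nonneg _) (hχ1 x)).trans (hM x)
  obtain ⟨F, hF⟩ := exists_diffeo_elem hHs hHd hHM
  refine ⟨F, ?_, fun x hx => ?_⟩
  · refine IsCompact.of_isClosed_subset hχc isClosed_closure
      (closure_mono fun x hx => ?_)
    contrapose! hx
    have : χ x = 0 := by simpa using hx
    simp [hF, elem, hH, this]
  · rw [hF, elem, elem, hH]
    simp [hχR x hx, clampMap_of_norm_le hr0 (hx.trans (hr ▸ le_max_right _ _))]

/-! ### The model map -/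

/-- The monotone form of the hypothesis spares the computation of partial derivatives of the factors
of `model`. -/
theorem realizable_elem_of_monotone (i : Fin 4) {G : R4 → ℝ} (hG : ContDiff ℝ ∞ G) {c : ℝ}
    (hc0 : 0 ≤ c) (hc : c < 1) (hm : ∀ x, Monotone fun t : ℝ => G (x + t • stdVec i) + c * t) :
    Realizable (elem i G) := by
  refine realizable_elem i hG hc0 hc fun x => ?_
  have h1 := (hasDerivAt_line i hG x 0).add ((hasDerivAt_id (0 : ℝ)).const_mul c)
  have h2 : 0 ≤ deriv (fun t : ℝ => G (x + t • stdVec i) + c * t) 0 := (hm x).deriv_nonneg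
  have h3 : deriv (fun t : ℝ => G (x + t • stdVec i) + c * t) 0 = _ := h1.deriv
  rw [h3] at h2
  simp only [zero_smul, add_zero, mul_one] at h2
  linarith

/-- Strong expansion near the origin, contraction away from it. -/
noncomputable def expand (x : ℝ) : ℝ := x / 8 + (512 - 1 / 8) * clamp (1 / 128) x

/-- A smooth step from `0` on `(-∞, 1]` to `1` on `[2, ∞)`. -/
noncomputable def twist (t : ℝ) : ℝ := Real.smoothTransition (t - 1)

/-- A smooth bump that is `1` on `[1, 2]` and vanishes outside `[1/2, 5/2]`. -/
noncomputable def push (t : ℝ) : ℝ :=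
  Real.smoothTransition (2 * t - 1) * Real.smoothTransition (5 - 2 * t)

/-- A smooth step from `0` on `(-∞, 0]` to `-3` on `[1/4, ∞)`. -/
noncomputable def fold (t : ℝ) : ℝ := -3 * Real.smoothTransition (4 * t)

theorem contDiff_expand : ContDiff ℝ ∞ expand :=
  (contDiff_id.div_const 8).add (contDiff_const.mul (contDiff_clamp _))

theorem contDiff_twist : ContDiff ℝ ∞ twist :=
  Real.smoothTransition.contDiff.comp (contDiff_id.sub contDiff_const)

theorem contDiff_push : ContDiff ℝ ∞ push :=
  (Real.smoothTransition.contDiff.comp ((contDiff_const.mul contDiff_id).sub contDiff_const)).mul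
    (Real.smoothTransition.contDiff.comp (contDiff_const.sub (contDiff_const.mul contDiff_id)))

theorem contDiff_fold : ContDiff ℝ ∞ fold :=
  contDiff_const.mul (Real.smoothTransition.contDiff.comp (contDiff_const.mul contDiff_id))

theorem twist_nonneg (t : ℝ) : 0 ≤ twist t := Real.smoothTransition.nonneg _

theorem twist_le_one (t : ℝ) : twist t ≤ 1 := Real.smoothTransition.le_one _

theorem twist_of_le {t : ℝ} (h : t ≤ 1) : twist t = 0 :=
  Real.smoothTransition.zero_of_nonpos (by linarith)

theorem twist_of_ge {t : ℝ} (h : 2 ≤ t) : twist t = 1 :=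
  Real.smoothTransition.one_of_one_le (by linarith)

theorem push_nonneg (t : ℝ) : 0 ≤ push t :=
  mul_nonneg (Real.smoothTransition.nonneg _) (Real.smoothTransition.nonneg _)

theorem push_le_one (t : ℝ) : push t ≤ 1 :=
  mul_le_one₀ (Real.smoothTransition.le_one _) (Real.smoothTransition.nonneg _)
    (Real.smoothTransition.le_one _)

theorem push_of_le {t : ℝ} (h : t ≤ 1 / 2) : push t = 0 := by
  rw [push, Real.smoothTransition.zero_of_nonpos (by linarith), zero_mul]

theorem push_of_ge {t : ℝ} (h : 5 / 2 ≤ t) : push t = 0 := by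
  rw [push, Real.smoothTransition.zero_of_nonpos (x := 5 - 2 * t) (by linarith), mul_zero]

theorem push_of_mem {t : ℝ} (h1 : 1 ≤ t) (h2 : t ≤ 2) : push t = 1 := by
  rw [push, Real.smoothTransition.one_of_one_le (by linarith),
    Real.smoothTransition.one_of_one_le (by linarith), one_mul]

theorem fold_of_le {t : ℝ} (h : t ≤ 0) : fold t = 0 := by
  rw [fold, Real.smoothTransition.zero_of_nonpos (by linarith), mul_zero]

theorem fold_of_ge {t : ℝ} (h : 1 / 4 ≤ t) : fold t = -3 := by
  rw [fold, Real.smoothTransition.one_of_one_le (by linarith), mul_one]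

theorem fold_mem (t : ℝ) : -3 ≤ fold t ∧ fold t ≤ 0 := by
  have h0 := Real.smoothTransition.nonneg (4 * t)
  have h1 := Real.smoothTransition.le_one (4 * t)
  constructor <;> rw [fold] <;> linarith

theorem expand_of_abs_le {x : ℝ} (h : |x| ≤ 1 / 128) : expand x = 512 * x := by
  rw [expand, clamp_of_abs_le (by norm_num) h]; ring

/-- At the edge of the linear zone the value is `512 / 128 = 4`, and `expand` is increasing. -/
theorem four_le_abs_expand {x : ℝ} (h : 1 / 128 ≤ |x|) : 4 ≤ |expand x| := by
  rcases le_abs'.1 h with h | h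
  · refine le_abs.2 (Or.inr ?_)
    have := le_clamp (r := 1 / 128) (x := -x) (by norm_num) (by linarith)
    rw [clamp_neg] at this
    rw [expand]; linarith
  · refine le_abs.2 (Or.inl ?_)
    have := le_clamp (r := 1 / 128) (x := x) (by norm_num) h
    rw [expand]; linarith

/-- The range `25 = 12 + 13` covers `x 1 + 13 * push (x 0)` on `outerTrap`; the value is below `25 /
8 + 512 / 64`. -/
theorem abs_expand_lt {x : ℝ} (h : |x| ≤ 25) : |expand x| < 12 := by
  have h1 := abs_le.1 (abs_clamp_le (r := 1 / 128) (by norm_num) x)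
  have h2 := abs_le.1 h
  rw [expand, abs_lt]
  constructor <;> linarith

/-- The contracted third coordinate. -/
noncomputable def contr2 (x : R4) : ℝ := x 2 / 16 + 15 / 16 * (twist (x 0) - 1 / 2)

/-- The fourth coordinate of the model map. -/
noncomputable def out3 (x : R4) : ℝ :=
  x 3 / 16 + twist (x 0) * Real.arctan (1024 * x 3) - (1 - twist (x 0)) * (contr2 x + 1 / 2)

/-- The third coordinate of the model map. -/
noncomputable def out2 (x : R4) : ℝ := contr2 x + (1 - twist (x 0)) * out3 x

/-- The model map: a horseshoe with strong expansion in the first two coordinates, whose two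
branches act on the last two coordinates by a spiral sink and by a saddle. -/
noncomputable def model (x : R4) : R4 :=
  !₂[-expand (x 1 + 13 * push (x 0)), expand (x 0 + fold (out2 x)), out2 x, out3 x]

/-- The three factors applied last realise the quarter turn `(u, v) ↦ (-v, u)` as shears; the first
of these three also performs the expansion of the coordinate `x 0`. -/
theorem model_eq_comp : model =
    elem 0 (fun x => -x 1) ∘ elem 1 (fun x => x 0) ∘
    elem 0 (fun x => expand (x 0 + fold (x 2)) - x 1 - x 0) ∘
    elem 1 (fun x => expand (x 1 + 13 * push (x 0)) - x 1) ∘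
    elem 2 (fun x => (1 - twist (x 0)) * x 3) ∘
    elem 3 (fun x => -(15 / 16) * x 3 + twist (x 0) * Real.arctan (1024 * x 3)
      - (1 - twist (x 0)) * (x 2 + 1 / 2)) ∘
    elem 2 (fun x => -(15 / 16) * x 2 + 15 / 16 * (twist (x 0) - 1 / 2)) := by
  funext x
  set y1 := elem 2 (fun x => -(15 / 16) * x 2 + 15 / 16 * (twist (x 0) - 1 / 2)) x with h1
  set y2 := elem 3 (fun x => -(15 / 16) * x 3 + twist (x 0) * Real.arctan (1024 * x 3)
      - (1 - twist (x 0)) * (x 2 + 1 / 2)) y1 with h2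
  set y3 := elem 2 (fun x => (1 - twist (x 0)) * x 3) y2 with h3
  have a0 : y1 0 = x 0 := elem_apply_ne (by decide) _ _
  have a1 : y1 1 = x 1 := elem_apply_ne (by decide) _ _
  have a2 : y1 2 = contr2 x := by rw [h1, elem_apply_self, contr2]; ring
  have a3 : y1 3 = x 3 := elem_apply_ne (by decide) _ _
  have b0 : y2 0 = x 0 := (elem_apply_ne (by decide) _ _).trans a0
  have b1 : y2 1 = x 1 := (elem_apply_ne (by decide) _ _).trans a1
  have b2 : y2 2 = contr2 x := (elem_apply_ne (by decide) _ _).trans a2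
  have b3 : y2 3 = out3 x := by rw [h2, elem_apply_self, a0, a2, a3, out3]; ring
  have c0 : y3 0 = x 0 := (elem_apply_ne (by decide) _ _).trans b0
  have c1 : y3 1 = x 1 := (elem_apply_ne (by decide) _ _).trans b1
  have c2 : y3 2 = out2 x := by rw [h3, elem_apply_self, b0, b2, b3, out2]
  have c3 : y3 3 = out3 x := (elem_apply_ne (by decide) _ _).trans b3
  simp only [Function.comp_apply, ← h1, ← h2, ← h3]
  set y4 := elem 1 (fun x => expand (x 1 + 13 * push (x 0)) - x 1) y3 with h4
  have d0 : y4 0 = x 0 := (elem_apply_ne (by decide) _ _).trans c0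
  have d1 : y4 1 = expand (x 1 + 13 * push (x 0)) := by
    rw [h4, elem_apply_self, c0, c1]; ring
  have d2 : y4 2 = out2 x := (elem_apply_ne (by decide) _ _).trans c2
  have d3 : y4 3 = out3 x := (elem_apply_ne (by decide) _ _).trans c3
  set y5 := elem 0 (fun x => expand (x 0 + fold (x 2)) - x 1 - x 0) y4 with h5
  have e0 : y5 0 = expand (x 0 + fold (out2 x)) - expand (x 1 + 13 * push (x 0)) := by
    rw [h5, elem_apply_self, d0, d1, d2]; ring
  have e1 : y5 1 = expand (x 1 + 13 * push (x 0)) := (elem_apply_ne (by decide) _ _).trans d1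
  have e2 : y5 2 = out2 x := (elem_apply_ne (by decide) _ _).trans d2
  have e3 : y5 3 = out3 x := (elem_apply_ne (by decide) _ _).trans d3
  set y6 := elem 1 (fun x => x 0) y5 with h6
  have f0 : y6 0 = expand (x 0 + fold (out2 x)) - expand (x 1 + 13 * push (x 0)) :=
    (elem_apply_ne (by decide) _ _).trans e0
  have f1 : y6 1 = expand (x 0 + fold (out2 x)) := by rw [h6, elem_apply_self, e0, e1]; ring
  have f2 : y6 2 = out2 x := (elem_apply_ne (by decide) _ _).trans e2
  have f3 : y6 3 = out3 x := (elem_apply_ne (by decide) _ _).trans e3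
  ext j
  fin_cases j
  · change _ = elem 0 _ y6 0
    rw [elem_apply_self, f0, f1]
    change -expand (x 1 + 13 * push (x 0)) = _
    ring
  · exact ((elem_apply_ne (by decide) _ _).trans f1).symm
  · exact ((elem_apply_ne (by decide) _ _).trans f2).symm
  · exact ((elem_apply_ne (by decide) _ _).trans f3).symm

theorem add_smul_stdVec_apply_self (x : R4) (t : ℝ) (i : Fin 4) :
    (x + t • stdVec i) i = x i + t := by simp

theorem add_smul_stdVec_apply_ne (x : R4) (t : ℝ) {i j : Fin 4} (h : j ≠ i) :
    (x + t • stdVec i) j = x j := by simp [h]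

theorem contDiff_coord (j : Fin 4) : ContDiff ℝ ∞ fun x : R4 => x j := contDiff_piLp_apply 2

theorem realizable_model : Realizable model := by
  have hp : ∀ j : Fin 4, ContDiff ℝ ∞ fun x : R4 => x j := contDiff_coord
  have ht := contDiff_twist.comp (hp 0)
  have g1 : ContDiff ℝ ∞ fun x : R4 => -(15 / 16) * x 2 + 15 / 16 * (twist (x 0) - 1 / 2) :=
    (contDiff_const.mul (hp 2)).add (contDiff_const.mul (ht.sub contDiff_const))
  have g2 : ContDiff ℝ ∞ fun x : R4 => -(15 / 16) * x 3 + twist (x 0) * Real.arctan (1024 * x 3)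
      - (1 - twist (x 0)) * (x 2 + 1 / 2) :=
    ((contDiff_const.mul (hp 3)).add (ht.mul
      (Real.contDiff_arctan.comp (contDiff_const.mul (hp 3))))).sub
      ((contDiff_const.sub ht).mul ((hp 2).add contDiff_const))
  have g3 : ContDiff ℝ ∞ fun x : R4 => (1 - twist (x 0)) * x 3 :=
    (contDiff_const.sub ht).mul (hp 3)
  have g4 : ContDiff ℝ ∞ fun x : R4 => expand (x 1 + 13 * push (x 0)) - x 1 :=
    (contDiff_expand.comp ((hp 1).add (contDiff_const.mul (contDiff_push.comp (hp 0))))).sub (hp 1)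
  have g5 : ContDiff ℝ ∞ fun x : R4 => expand (x 0 + fold (x 2)) - x 1 - x 0 :=
    ((contDiff_expand.comp ((hp 0).add (contDiff_fold.comp (hp 2)))).sub (hp 1)).sub (hp 0)
  -- `expand` has slope at least `1/8`, so its displacement has slope at least `-7/8`, within the
  -- common bound `-15/16`.
  have hexp : ∀ u : ℝ, Monotone fun t : ℝ => expand (u + t) - t / 8 := fun u s t hst => by
    have := clamp_monotone (1 / 128) (add_le_add_right hst u)
    simp only [expand]
    linarith
  have r1 := realizable_elem_of_monotone 2 g1 (c := 15 / 16) (by norm_num) (by norm_num)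
    fun x s t hst => by
      simp only [add_smul_stdVec_apply_self,
        add_smul_stdVec_apply_ne x _ (show (0 : Fin 4) ≠ 2 by decide)]
      linarith
  have r2 := realizable_elem_of_monotone 3 g2 (c := 15 / 16) (by norm_num) (by norm_num)
    fun x s t hst => by
      have h := Real.arctan_strictMono.monotone
        (show 1024 * (x 3 + s) ≤ 1024 * (x 3 + t) by linarith)
      have := mul_le_mul_of_nonneg_left h (twist_nonneg (x 0))
      simp only [add_smul_stdVec_apply_self, add_smul_stdVec_apply_ne x _ (show (0 : Fin 4) ≠ 3 by decide),
        add_smul_stdVec_apply_ne x _ (show (2 : Fin 4) ≠ 3 by decide)]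
      linarith
  have r3 := realizable_elem_of_monotone 2 g3 (c := 0) le_rfl (by norm_num)
    fun x s t hst => by
      simp
  have r4 := realizable_elem_of_monotone 1 g4 (c := 15 / 16) (by norm_num) (by norm_num)
    fun x s t hst => by
      have h := hexp (x 1 + 13 * push (x 0)) hst
      simp only [add_smul_stdVec_apply_self, add_smul_stdVec_apply_ne x _ (show (0 : Fin 4) ≠ 1 by decide),
        add_right_comm _ s, add_right_comm _ t] at h ⊢
      linarith
  have r5 := realizable_elem_of_monotone 0 g5 (c := 15 / 16) (by norm_num) (by norm_num)
    fun x s t hst => by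
      have h := hexp (x 0 + fold (x 2)) hst
      simp only [add_smul_stdVec_apply_self, add_smul_stdVec_apply_ne x _ (show (1 : Fin 4) ≠ 0 by decide),
        add_smul_stdVec_apply_ne x _ (show (2 : Fin 4) ≠ 0 by decide),
        add_right_comm _ s, add_right_comm _ t] at h ⊢
      linarith
  have r6 := realizable_elem_of_monotone 1 (hp 0) (c := 0) le_rfl (by norm_num)
    fun x s t hst => by simp
  have r7 := realizable_elem_of_monotone 0 (hp 1).neg (c := 0) le_rfl (by norm_num)
    fun x s t hst => by simp
  have k1 := (contDiff_elem 2 g1).continuous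
  have k2 := (contDiff_elem 3 g2).continuous.comp k1
  have k3 := (contDiff_elem 2 g3).continuous.comp k2
  have k4 := (contDiff_elem 1 g4).continuous.comp k3
  have k5 := (contDiff_elem 0 g5).continuous.comp k4
  have k6 := (contDiff_elem 1 (hp 0)).continuous.comp k5
  rw [model_eq_comp]
  exact r7.comp (r6.comp (r5.comp (r4.comp (r3.comp (r2.comp r1 k1) k2) k3) k4) k5) k6

/-! ### The two branches of the model map -/

/-- The bound on `x 3` exceeds the one in `outerTrap`, so that the formula holds near boundary
points too and can be differentiated there. The same applies to `x 2` in `model_right`. -/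
theorem model_left {x : R4} (h0 : |x 0| ≤ 1 / 128) (h1 : |x 1| ≤ 1 / 128) (h3 : |x 3| ≤ 3) :
    model x = !₂[-(512 * x 1), 512 * x 0, -1 / 2 + x 3 / 16, x 3 / 16 - (x 2 + 1 / 2) / 16] := by
  have hx := abs_le.1 h0
  have ht : twist (x 0) = 0 := twist_of_le (by linarith)
  have ho3 : out3 x = x 3 / 16 - (x 2 + 1 / 2) / 16 := by rw [out3, contr2, ht]; ring
  have ho2 : out2 x = -1 / 2 + x 3 / 16 := by rw [out2, ho3, contr2, ht]; ring
  have hf : fold (out2 x) = 0 := fold_of_le (by rw [ho2]; linarith [(abs_le.1 h3).2])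
  rw [model, hf, push_of_le (by linarith), mul_zero, add_zero, add_zero, expand_of_abs_le h0,
    expand_of_abs_le h1, ho2, ho3]

theorem model_right {x : R4} (h0 : |x 0 - 3| ≤ 1 / 128) (h1 : |x 1| ≤ 1 / 128)
    (h2 : |x 2| ≤ 7 / 2) :
    model x = !₂[-(512 * x 1), 512 * (x 0 - 3), 1 / 2 + (x 2 - 1 / 2) / 16,
      x 3 / 16 + Real.arctan (1024 * x 3)] := by
  have hx := abs_le.1 h0
  have ht : twist (x 0) = 1 := twist_of_ge (by linarith)
  have ho3 : out3 x = x 3 / 16 + Real.arctan (1024 * x 3) := by rw [out3, contr2, ht]; ring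
  have ho2 : out2 x = 1 / 2 + (x 2 - 1 / 2) / 16 := by rw [out2, contr2, ht]; ring
  have hf : fold (out2 x) = -3 := fold_of_ge (by rw [ho2]; linarith [(abs_le.1 h2).1])
  rw [model, hf, push_of_ge (by linarith), mul_zero, add_zero, ← sub_eq_add_neg,
    expand_of_abs_le h0, expand_of_abs_le h1, ho2, ho3]

/-! ### The filtration -/

/-- The open region where the model map expands. -/
def strips : Set R4 :=
  {x | |x 1| < 1 / 128 ∧ (|x 0| < 1 / 128 ∨ |x 0 - 3| < 1 / 128)}

/-- The outer attracting region. -/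
def outerTrap : Set R4 := {x | (|x 0| ≤ 12 ∧ |x 1| ≤ 12) ∧ |x 2| ≤ 3 ∧ |x 3| ≤ 2}

/-- The inner attracting region. -/
def innerTrap : Set R4 := outerTrap \ strips

theorem mem_outerTrap_diff_innerTrap {x : R4} : x ∈ outerTrap \ innerTrap ↔
    x ∈ outerTrap ∧ x ∈ strips := by
  rw [innerTrap, Set.sdiff_sdiff_right_self, Set.mem_inter_iff]

theorem continuous_abs_coord (j : Fin 4) : Continuous fun x : R4 => |x j| :=
  (contDiff_coord j).continuous.abs

theorem isOpen_strips : IsOpen strips :=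
  (isOpen_lt (continuous_abs_coord 1) continuous_const).inter
    ((isOpen_lt (continuous_abs_coord 0) continuous_const).union
      (isOpen_lt ((contDiff_coord 0).continuous.sub continuous_const).abs continuous_const))

theorem norm_le_of_mem_outerTrap {x : R4} (hx : x ∈ outerTrap) : ‖x‖ ≤ 20 := by
  obtain ⟨⟨h0, h1⟩, h2, h3⟩ := hx
  rw [EuclideanSpace.norm_eq, Real.sqrt_le_left (by norm_num), Fin.sum_univ_four]
  simp only [Real.norm_eq_abs]
  have := pow_le_pow_left₀ (abs_nonneg _) h0 2
  have := pow_le_pow_left₀ (abs_nonneg _) h1 2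
  have := pow_le_pow_left₀ (abs_nonneg _) h2 2
  have := pow_le_pow_left₀ (abs_nonneg _) h3 2
  linarith

theorem isCompact_outerTrap : IsCompact outerTrap := by
  refine (isCompact_closedBall (0 : R4) 20).of_isClosed_subset ?_ fun x hx => by
    simpa using norm_le_of_mem_outerTrap hx
  exact ((isClosed_le (continuous_abs_coord 0) continuous_const).inter
    (isClosed_le (continuous_abs_coord 1) continuous_const)).inter
    ((isClosed_le (continuous_abs_coord 2) continuous_const).inter
    (isClosed_le (continuous_abs_coord 3) continuous_const))

theorem isCompact_innerTrap : IsCompact innerTrap := isCompact_outerTrap.diff isOpen_strips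

/-- An open set inside `outerTrap`. -/
def outerTrapInterior : Set R4 := {x | (|x 0| < 12 ∧ |x 1| < 12) ∧ |x 2| < 3 ∧ |x 3| < 2}

theorem isOpen_outerTrapInterior : IsOpen outerTrapInterior :=
  ((isOpen_lt (continuous_abs_coord 0) continuous_const).inter
    (isOpen_lt (continuous_abs_coord 1) continuous_const)).inter
    ((isOpen_lt (continuous_abs_coord 2) continuous_const).inter
    (isOpen_lt (continuous_abs_coord 3) continuous_const))

theorem outerTrapInterior_subset : outerTrapInterior ⊆ outerTrap :=
  fun _ h => ⟨⟨h.1.1.le, h.1.2.le⟩, h.2.1.le, h.2.2.le⟩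

/-- The points far away from the strips. -/
def farFromStrips : Set R4 := {x | 7 / 2 < |x 0| ∨ 7 / 2 < |x 1|}

theorem isOpen_farFromStrips : IsOpen farFromStrips :=
  (isOpen_lt continuous_const (continuous_abs_coord 0)).union
    (isOpen_lt continuous_const (continuous_abs_coord 1))

theorem farFromStrips_subset : farFromStrips ⊆ stripsᶜ := by
  rintro x hx ⟨h1, h0⟩
  rcases hx with h | h
  · rcases h0 with h0 | h0
    · linarith
    · have := abs_lt.1 h0
      rw [abs_of_pos (by linarith)] at h
      linarith
  · linarith

/-- `out3` adds to `x 3 / 16` a convex combination of an `arctan`, below `π / 2`, and a term of size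
at most `3 / 2`. -/
theorem out_bounds {x : R4} (h2 : |x 2| ≤ 3) (h3 : |x 3| ≤ 2) : |out2 x| < 3 ∧ |out3 x| < 2 := by
  have a2 := abs_le.1 h2
  have a3 := abs_le.1 h3
  have t0 := twist_nonneg (x 0)
  have t1 := twist_le_one (x 0)
  have p1 := Real.arctan_lt_pi_div_two (1024 * x 3)
  have p2 := Real.neg_pi_div_two_lt_arctan (1024 * x 3)
  have p3 := Real.pi_lt_d2
  have hc : -1 ≤ contr2 x ∧ contr2 x ≤ 1 := by
    rw [contr2]; constructor <;> linarith
  have ho3 : |out3 x| < 2 := by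
    rw [out3, abs_lt]
    constructor <;> nlinarith
  have b3 := abs_lt.1 ho3
  refine ⟨?_, ho3⟩
  rw [out2, abs_lt]
  constructor <;> nlinarith

theorem model_apply_zero (x : R4) : model x 0 = -expand (x 1 + 13 * push (x 0)) := rfl

theorem model_apply_one (x : R4) : model x 1 = expand (x 0 + fold (out2 x)) := rfl

theorem model_mem_outerTrapInterior {x : R4} (hx : x ∈ outerTrap) : model x ∈ outerTrapInterior := by
  obtain ⟨⟨h0, h1⟩, h2, h3⟩ := hx
  have a0 := abs_le.1 h0
  have a1 := abs_le.1 h1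
  refine ⟨⟨?_, ?_⟩, out_bounds h2 h3⟩
  · rw [model_apply_zero, abs_neg]
    refine abs_expand_lt (abs_le.2 ⟨?_, ?_⟩) <;>
      linarith [push_nonneg (x 0), push_le_one (x 0)]
  · rw [model_apply_one]
    refine abs_expand_lt (abs_le.2 ⟨?_, ?_⟩) <;> linarith [fold_mem (out2 x)]

/-- It suffices that one argument of `expand` has modulus at least `1/128`. For `x 0 ≤ 1` or `x 0 ≥
2`, `fold` recentres at 0 or 3, and failure of both bounds would put `x` in a strip. For `1 ≤ x 0 ≤
2`, the full push by 13 beats `|x 1| ≤ 12`. -/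
theorem model_mem_farFromStrips {x : R4} (hx : x ∈ innerTrap) : model x ∈ farFromStrips := by
  obtain ⟨⟨⟨h0, h1⟩, h2, h3⟩, hs⟩ := hx
  have a0 := abs_le.1 h0
  have a1 := abs_le.1 h1
  have a2 := abs_le.1 h2
  have a3 := abs_le.1 h3
  suffices h : 1 / 128 ≤ |x 1 + 13 * push (x 0)| ∨ 1 / 128 ≤ |x 0 + fold (out2 x)| by
    rcases h with h | h
    · left
      rw [model_apply_zero, abs_neg]
      linarith [four_le_abs_expand h]
    · right
      rw [model_apply_one]
      linarith [four_le_abs_expand h]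
  rcases le_total (x 0) 1 with hl | hl
  · have ht : twist (x 0) = 0 := twist_of_le hl
    have ho2 : out2 x = -1 / 2 + x 3 / 16 := by rw [out2, out3, contr2, ht]; ring
    rw [fold_of_le (by rw [ho2]; linarith), add_zero]
    by_cases hc : |x 0| < 1 / 128
    · left
      rw [push_of_le (by linarith [abs_lt.1 hc]), mul_zero, add_zero]
      by_contra! h
      exact hs ⟨h, Or.inl hc⟩
    · exact Or.inr (not_lt.1 hc)
  · rcases le_total (x 0) 2 with hr | hr
    · left
      rw [push_of_mem hl hr]
      exact le_trans (by linarith) (le_abs_self _)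
    · have ht : twist (x 0) = 1 := twist_of_ge hr
      have ho2 : out2 x = 1 / 2 + (x 2 - 1 / 2) / 16 := by rw [out2, contr2, ht]; ring
      rw [fold_of_ge (by rw [ho2]; linarith), ← sub_eq_add_neg]
      by_cases hc : |x 0 - 3| < 1 / 128
      · left
        rw [push_of_ge (by linarith [abs_lt.1 hc]), mul_zero, add_zero]
        by_contra! h
        exact hs ⟨h, Or.inr hc⟩
      · exact Or.inr (not_lt.1 hc)

theorem model_image_outerTrap {x : R4} (hx : x ∈ outerTrap) : model x ∈ interior outerTrap :=
  interior_maximal outerTrapInterior_subset isOpen_outerTrapInterior (model_mem_outerTrapInterior hx)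

theorem outerTrapInterior_inter_subset : outerTrapInterior ∩ farFromStrips ⊆ innerTrap :=
  fun _ h => ⟨outerTrapInterior_subset h.1, farFromStrips_subset h.2⟩

theorem model_image_innerTrap {x : R4} (hx : x ∈ innerTrap) : model x ∈ interior innerTrap :=
  interior_maximal outerTrapInterior_inter_subset (isOpen_outerTrapInterior.inter isOpen_farFromStrips)
    ⟨model_mem_outerTrapInterior hx.1, model_mem_farFromStrips hx⟩

/-! ### Block linear maps -/

/-- The matrix that acts by `b` times a right angle rotation on the first two coordinates and by
`!![p, q; r, s]` on the last two. -/
def blockMatrix (b p q r s : ℝ) : Matrix (Fin 4) (Fin 4) ℝ :=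
  !![0, -b, 0, 0; b, 0, 0, 0; 0, 0, p, q; 0, 0, r, s]

/-- The continuous linear map with matrix `blockMatrix b p q r s`. -/
noncomputable def blockMap (b p q r s : ℝ) : R4 →L[ℝ] R4 :=
  LinearMap.toContinuousLinearMap (Matrix.toEuclideanLin (blockMatrix b p q r s))

theorem blockMap_apply (b p q r s : ℝ) (v : R4) : blockMap b p q r s v =
    !₂[-b * v 1, b * v 0, p * v 2 + q * v 3, r * v 2 + s * v 3] := by
  ext j
  fin_cases j <;>
    simp [blockMap, blockMatrix, Matrix.toLpLin_apply, dotProduct,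
      Fin.sum_univ_four]

open Polynomial in
theorem charpoly_blockMap (b p q r s : ℝ) : (blockMap b p q r s).toLinearMap.charpoly =
    (X ^ 2 + C (b ^ 2)) * (X ^ 2 - C (p + s) * X + C (p * s - q * r)) := by
  have h : (blockMap b p q r s).toLinearMap = Matrix.toLin (PiLp.basisFun 2 ℝ (Fin 4))
      (PiLp.basisFun 2 ℝ (Fin 4)) (blockMatrix b p q r s) := by
    rw [← Matrix.toLpLin_eq_toLin]; rfl
  rw [h, Matrix.charpoly_toLin, Matrix.charpoly]
  have : (blockMatrix b p q r s).charmatrix = !![X, C b, 0, 0; -C b, X, 0, 0;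
      0, 0, X - C p, -C q; 0, 0, -C r, X - C s] := by
    ext i j : 2
    fin_cases i <;> fin_cases j <;> simp [blockMatrix]
  rw [this]
  simp [Matrix.det_succ_row_zero, Fin.sum_univ_succ, Fin.succAbove, Matrix.submatrix]
  ring

open Polynomial in
theorem aroots_eq_of_eq_prod {p : ℝ[X]} {a b c d : ℂ}
    (h : p.map (algebraMap ℝ ℂ) = (X - C a) * (X - C b) * (X - C c) * (X - C d)) :
    p.aroots ℂ = {a, b, c, d} := by
  rw [aroots, h, ← roots_multiset_prod_X_sub_C {a, b, c, d}]
  simp [mul_assoc]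

/-! ### The third exterior power -/

open exteriorPower

/-- The standard orthonormal frame of the third exterior power. -/
noncomputable def wedgeFrame : Fin 4 → ⋀[ℝ]^3 R4 :=
  ![ιMulti ℝ 3 ![stdVec 0, stdVec 1, stdVec 2], ιMulti ℝ 3 ![stdVec 0, stdVec 1, stdVec 3],
    ιMulti ℝ 3 ![stdVec 0, stdVec 2, stdVec 3], ιMulti ℝ 3 ![stdVec 1, stdVec 2, stdVec 3]]

theorem inner_ιMulti_three (u v : Fin 3 → R4) :
    inner ℝ (ιMulti ℝ 3 u) (ιMulti ℝ 3 v) =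
      inner ℝ (u 0) (v 0) * (inner ℝ (u 1) (v 1) * inner ℝ (u 2) (v 2)
        - inner ℝ (u 2) (v 1) * inner ℝ (u 1) (v 2))
      - inner ℝ (u 1) (v 0) * (inner ℝ (u 0) (v 1) * inner ℝ (u 2) (v 2)
        - inner ℝ (u 2) (v 1) * inner ℝ (u 0) (v 2))
      + inner ℝ (u 2) (v 0) * (inner ℝ (u 0) (v 1) * inner ℝ (u 1) (v 2)
        - inner ℝ (u 1) (v 1) * inner ℝ (u 0) (v 2)) := by
  rw [inner_ιMulti_ιMulti, Matrix.det_fin_three]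
  simp only [Matrix.of_apply]
  ring

theorem inner_stdVec (i : Fin 4) (v : R4) : inner ℝ (stdVec i) v = v i := by
  simp [EuclideanSpace.inner_single_left]

theorem stdVec_apply (i j : Fin 4) : (stdVec i : R4) j = if j = i then 1 else 0 := by
  simp

theorem orthonormal_wedgeFrame : Orthonormal ℝ wedgeFrame := by
  rw [orthonormal_iff_ite]
  intro i j
  fin_cases i <;> fin_cases j <;>
    simp only [wedgeFrame, Fin.zero_eta, Fin.mk_one, Fin.reduceFinMk, Matrix.cons_val,
      inner_ιMulti_three, inner_stdVec, stdVec_apply] <;> simp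

/-- The standard orthonormal basis of the third exterior power. -/
noncomputable def wedgeBasis : OrthonormalBasis (Fin 4) ℝ (⋀[ℝ]^3 R4) :=
  (basisOfOrthonormalOfCardEqFinrank orthonormal_wedgeFrame (by
    rw [exteriorPower.finrank_eq, finrank_euclideanSpace, Fintype.card_fin]; rfl)).toOrthonormalBasis
    (by rw [coe_basisOfOrthonormalOfCardEqFinrank]; exact orthonormal_wedgeFrame)

theorem coe_wedgeBasis : ⇑wedgeBasis = wedgeFrame := by
  rw [wedgeBasis, Module.Basis.coe_toOrthonormalBasis, coe_basisOfOrthonormalOfCardEqFinrank]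

/-- Wedges containing both of the first two axes gain `b ^ 2` and see the lower block; wedges
containing both of the last two gain its determinant and are turned by `b`. -/
theorem inner_wedgeFrame_map_blockMap (b p q r s : ℝ) (i j : Fin 4) :
    inner ℝ (wedgeFrame i)
      (exteriorPower.map 3 (blockMap b p q r s).toLinearMap (wedgeFrame j)) =
    (!![b ^ 2 * p, b ^ 2 * q, 0, 0; b ^ 2 * r, b ^ 2 * s, 0, 0;
      0, 0, 0, -b * (p * s - q * r); 0, 0, b * (p * s - q * r), 0] : Matrix _ _ ℝ) i j := by
  fin_cases i <;> fin_cases j <;>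
    simp only [wedgeFrame, Fin.zero_eta, Fin.mk_one, Fin.reduceFinMk, Matrix.cons_val,
      map_apply_ιMulti, inner_ιMulti_three, inner_stdVec, Function.comp_apply,
      ContinuousLinearMap.coe_coe, blockMap_apply, stdVec_apply] <;> simp <;> ring_nf <;> simp

theorem norm_sq_map_blockMap (b p q r s : ℝ) (w : ⋀[ℝ]^3 R4) :
    ‖exteriorPower.map 3 (blockMap b p q r s).toLinearMap w‖ ^ 2 =
      b ^ 4 * ((p * wedgeBasis.repr w 0 + q * wedgeBasis.repr w 1) ^ 2
        + (r * wedgeBasis.repr w 0 + s * wedgeBasis.repr w 1) ^ 2)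
      + b ^ 2 * (p * s - q * r) ^ 2 *
        (wedgeBasis.repr w 2 ^ 2 + wedgeBasis.repr w 3 ^ 2) := by
  have h : ∀ i, inner ℝ (wedgeBasis i) (exteriorPower.map 3 (blockMap b p q r s).toLinearMap w)
      = ∑ j, wedgeBasis.repr w j *
        (!![b ^ 2 * p, b ^ 2 * q, 0, 0; b ^ 2 * r, b ^ 2 * s, 0, 0;
          0, 0, 0, -b * (p * s - q * r); 0, 0, b * (p * s - q * r), 0] : Matrix _ _ ℝ) i j := by
    intro i
    conv_lhs => rw [← wedgeBasis.sum_repr w]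
    simp only [map_sum, map_smul, inner_sum, coe_wedgeBasis]
    exact Finset.sum_congr rfl fun j _ => (inner_smul_right _ _ _).trans
      (congrArg _ (inner_wedgeFrame_map_blockMap b p q r s i j))
  rw [← wedgeBasis.sum_sq_norm_inner_right]
  simp only [h, Fin.sum_univ_four, Real.norm_eq_abs, sq_abs]
  simp
  ring

theorem le_minNorm_map_blockMap {K b p q r s : ℝ} 
    (h1 : ∀ x y : ℝ, K ^ 2 * (x ^ 2 + y ^ 2) ≤
      b ^ 4 * ((p * x + q * y) ^ 2 + (r * x + s * y) ^ 2))
    (h2 : K ^ 2 ≤ b ^ 2 * (p * s - q * r) ^ 2) :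
    K ≤ minNorm (exteriorPower.map 3 (blockMap b p q r s).toLinearMap) := by
  refine le_csInf (Set.Nonempty.image _ ⟨wedgeBasis 0, by simp⟩) ?_
  rintro _ ⟨w, hw, rfl⟩
  have hw1 : ‖w‖ = 1 := by simpa using hw
  refine le_of_sq_le_sq ?_ (norm_nonneg _)
  have hsum : wedgeBasis.repr w 0 ^ 2 + wedgeBasis.repr w 1 ^ 2
      + (wedgeBasis.repr w 2 ^ 2 + wedgeBasis.repr w 3 ^ 2) = 1 := by
    have := wedgeBasis.sum_sq_norm_inner_right w
    simp only [Fin.sum_univ_four, Real.norm_eq_abs, sq_abs, hw1,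
      ← wedgeBasis.repr_apply_apply] at this
    linarith
  rw [norm_sq_map_blockMap]
  have h3 := h1 (wedgeBasis.repr w 0) (wedgeBasis.repr w 1)
  have h4 := mul_le_mul_of_nonneg_right h2
    (add_nonneg (sq_nonneg (wedgeBasis.repr w 2)) (sq_nonneg (wedgeBasis.repr w 3)))
  calc K ^ 2 = K ^ 2 * (wedgeBasis.repr w 0 ^ 2 + wedgeBasis.repr w 1 ^ 2
      + (wedgeBasis.repr w 2 ^ 2 + wedgeBasis.repr w 3 ^ 2)) := by rw [hsum, mul_one]
    _ ≤ _ := by linarith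

/-! ### Derivatives of the model map on its branches -/

theorem hasStrictFDerivAt_coord (x : R4) (j : Fin 4) :
    HasStrictFDerivAt (fun y : R4 => y j) (EuclideanSpace.proj j : R4 →L[ℝ] ℝ) x :=
  (EuclideanSpace.proj j : R4 →L[ℝ] ℝ).hasStrictFDerivAt

theorem hasStrictFDerivAt_of_coords {F : R4 → R4} {b p q r s : ℝ} {x : R4}
    (h0 : HasStrictFDerivAt (fun y => F y 0) ((-b) • (EuclideanSpace.proj 1 : R4 →L[ℝ] ℝ)) x)
    (h1 : HasStrictFDerivAt (fun y => F y 1) (b • (EuclideanSpace.proj 0 : R4 →L[ℝ] ℝ)) x)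
    (h2 : HasStrictFDerivAt (fun y => F y 2)
      (p • (EuclideanSpace.proj 2 : R4 →L[ℝ] ℝ) + q • (EuclideanSpace.proj 3 : R4 →L[ℝ] ℝ)) x)
    (h3 : HasStrictFDerivAt (fun y => F y 3)
      (r • (EuclideanSpace.proj 2 : R4 →L[ℝ] ℝ) + s • (EuclideanSpace.proj 3 : R4 →L[ℝ] ℝ)) x) :
    HasStrictFDerivAt F (blockMap b p q r s) x := by
  rw [hasStrictFDerivAt_euclidean]
  intro j
  fin_cases j
  · refine h0.congr_fderiv (ContinuousLinearMap.ext fun v => ?_)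
    simp [blockMap_apply]
  · refine h1.congr_fderiv (ContinuousLinearMap.ext fun v => ?_)
    simp [blockMap_apply]
  · refine h2.congr_fderiv (ContinuousLinearMap.ext fun v => ?_)
    simp [blockMap_apply]
  · refine h3.congr_fderiv (ContinuousLinearMap.ext fun v => ?_)
    simp [blockMap_apply]

theorem hasFDerivAt_model_left {x : R4} (h0 : |x 0| < 1 / 128) (h1 : |x 1| < 1 / 128)
    (h3 : |x 3| ≤ 2) :
    HasFDerivAt model (blockMap 512 0 (1 / 16) (-(1 / 16)) (1 / 16)) x := by
  have c := hasStrictFDerivAt_coord x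
  have h : HasStrictFDerivAt (fun x : R4 => (!₂[-(512 * x 1), 512 * x 0, -1 / 2 + x 3 / 16,
      x 3 / 16 - (x 2 + 1 / 2) / 16] : R4)) (blockMap 512 0 (1 / 16) (-(1 / 16)) (1 / 16)) x := by
    apply hasStrictFDerivAt_of_coords
    · exact ((c 1).const_mul 512).neg.congr_fderiv (by ext v; simp)
    · exact (c 0).const_mul 512
    · exact (((c 3).mul_const (16 : ℝ)⁻¹).const_add (-1 / 2)).congr_fderiv (by ext v; simp)
    · refine (((c 3).mul_const (16 : ℝ)⁻¹).sub
        (((c 2).add_const (1 / 2)).mul_const (16 : ℝ)⁻¹)).congr_fderiv ?_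
      ext v
      simp
      ring
  refine h.hasFDerivAt.congr_of_eventuallyEq ?_
  filter_upwards [(continuous_abs_coord 0).continuousAt.eventually_lt continuousAt_const h0,
    (continuous_abs_coord 1).continuousAt.eventually_lt continuousAt_const h1,
    (continuous_abs_coord 3).continuousAt.eventually_lt (continuousAt_const (y := (3 : ℝ)))
      (by linarith)] with y hy0 hy1 hy3
  exact model_left hy0.le hy1.le hy3.le

theorem hasFDerivAt_model_right {x : R4} (h0 : |x 0 - 3| < 1 / 128) (h1 : |x 1| < 1 / 128)
    (h2 : |x 2| ≤ 3) : HasFDerivAt model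
      (blockMap 512 (1 / 16) 0 0 (1 / 16 + 1024 * (1 / (1 + (1024 * x 3) ^ 2)))) x := by
  have c := hasStrictFDerivAt_coord x
  have h : HasStrictFDerivAt (fun x : R4 => (!₂[-(512 * x 1), 512 * (x 0 - 3),
      1 / 2 + (x 2 - 1 / 2) / 16, x 3 / 16 + Real.arctan (1024 * x 3)] : R4))
      (blockMap 512 (1 / 16) 0 0 (1 / 16 + 1024 * (1 / (1 + (1024 * x 3) ^ 2)))) x := by
    apply hasStrictFDerivAt_of_coords
    · exact ((c 1).const_mul 512).neg.congr_fderiv (by ext v; simp)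
    · exact ((c 0).sub_const 3).const_mul 512
    · exact ((((c 2).sub_const (1 / 2)).mul_const (16 : ℝ)⁻¹).const_add (1 / 2)).congr_fderiv
        (by ext v; simp)
    · refine (((c 3).mul_const (16 : ℝ)⁻¹).add
        ((c 3).const_mul 1024).arctan).congr_fderiv ?_
      ext v
      simp
      ring
  refine h.hasFDerivAt.congr_of_eventuallyEq ?_
  filter_upwards [((contDiff_coord 0).continuous.sub
      continuous_const).abs.continuousAt.eventually_lt continuousAt_const h0,
    (continuous_abs_coord 1).continuousAt.eventually_lt continuousAt_const h1,
    (continuous_abs_coord 2).continuousAt.eventually_lt (continuousAt_const (y := (7 / 2 : ℝ)))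
      (by linarith)] with y hy0 hy1 hy2
  exact model_right hy0.le hy1.le hy2.le

/-- On the strips inside the outer region, `model` expands three-dimensional volume. -/
theorem two_le_minNorm {F : R4 → R4} {x : R4} (hF : F =ᶠ[𝓝 x] model) (hx : x ∈ outerTrap)
    (hs : x ∈ strips) : 2 ≤ minNorm (exteriorCubeDeriv F x) := by
  rw [exteriorCubeDeriv, hF.fderiv_eq]
  obtain ⟨h1, h0 | h0⟩ := hs
  · rw [(hasFDerivAt_model_left h0 h1 hx.2.2).fderiv]
    -- The determinant condition is sharp: `512 * (1 / 16) ^ 2 = 2`.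
    refine le_minNorm_map_blockMap (fun u v => ?_) (by norm_num)
    nlinarith [sq_nonneg (u - 2 * v), sq_nonneg u, sq_nonneg v]
  · rw [(hasFDerivAt_model_right h0 h1 hx.2.1).fderiv]
    have hd : 0 ≤ 1024 * (1 / (1 + (1024 * x 3) ^ 2)) := by positivity
    set d := 1024 * (1 / (1 + (1024 * x 3) ^ 2)) with hdef
    refine le_minNorm_map_blockMap (fun u v => ?_) ?_
    · have h2 : (1 / 16) ^ 2 * v ^ 2 ≤ (1 / 16 + d) ^ 2 * v ^ 2 :=
        mul_le_mul_of_nonneg_right (by nlinarith) (sq_nonneg v)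
      nlinarith [sq_nonneg u, sq_nonneg v]
    · nlinarith

/-! ### Eigenvalues -/

/-- `α` and `β` are identified by the trace and determinant of the lower block. -/
theorem eigenvalues_of_hasFDerivAt {F : R4 → R4} {x : R4} {b p q r s : ℝ}
    (hF : HasFDerivAt F (blockMap b p q r s) x) {α β : ℂ} (hadd : α + β = (p + s : ℝ))
    (hmul : α * β = (p * s - q * r : ℝ)) :
    eigenvalues F x = {b * Complex.I, -(b * Complex.I), α, β} := by
  rw [eigenvalues, hF.fderiv, charpoly_blockMap]
  apply aroots_eq_of_eq_prod
  obtain ⟨w, hw⟩ : ∃ w : ℂ, w = b * Complex.I := ⟨_, rfl⟩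
  have hb : (Polynomial.C ((b : ℂ) ^ 2)) = -(Polynomial.C w * Polynomial.C w) := by
    rw [← Polynomial.C_mul, ← Polynomial.C_neg, hw]
    congr 1
    linear_combination (b : ℂ) ^ 2 * Complex.I_sq
  simp only [Polynomial.map_mul, Polynomial.map_add, Polynomial.map_sub, Polynomial.map_pow,
    Polynomial.map_X, Polynomial.map_C, Complex.coe_algebraMap]
  rw [← hadd, ← hmul, Complex.ofReal_pow, hb, ← hw, Polynomial.C_add,
    Polynomial.C_mul (a := α), Polynomial.C_neg]
  ring

theorem index_of_eigenvalues {F : R4 → R4} {x : R4} {a b c d : ℂ}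
    (h : eigenvalues F x = {a, b, c, d}) :
    index F x = (if 1 < ‖d‖ then 1 else 0) + (if 1 < ‖c‖ then 1 else 0)
      + (if 1 < ‖b‖ then 1 else 0) + (if 1 < ‖a‖ then 1 else 0) := by
  classical
  rw [index, h]
  simp only [Multiset.insert_eq_cons, ← Multiset.cons_zero, Multiset.countP_cons,
    Multiset.countP_zero, zero_add]

/-- Two sorted lists of moduli that are permutations of each other coincide, so the middle entries
have modulus `‖a‖`, which only `a` and `b` attain. -/
theorem middle_eigenvalues {a b c d σ μ₁ μ₂ μ₃ : ℂ}
    (h : ({a, b, c, d} : Multiset ℂ) = {σ, μ₁, μ₂, μ₃})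
    (hab : ‖a‖ = ‖b‖) (hc : ‖c‖ < ‖a‖) (hd : ‖a‖ < ‖d‖)
    (h1 : ‖σ‖ ≤ ‖μ₁‖) (h2 : ‖μ₁‖ ≤ ‖μ₂‖) (h3 : ‖μ₂‖ ≤ ‖μ₃‖) :
    (μ₁ = a ∨ μ₁ = b) ∧ (μ₂ = a ∨ μ₂ = b) := by
  have hperm : [‖c‖, ‖a‖, ‖b‖, ‖d‖].Perm [‖σ‖, ‖μ₁‖, ‖μ₂‖, ‖μ₃‖] := by
    have h' : [a, b, c, d].Perm [σ, μ₁, μ₂, μ₃] := Multiset.coe_eq_coe.1 h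
    refine List.Perm.trans ?_ (h'.map norm)
    exact (List.perm_append_comm (l₁ := [‖c‖]) (l₂ := [‖a‖, ‖b‖])).append_right [‖d‖]
  have heq : [‖c‖, ‖a‖, ‖b‖, ‖d‖] = [‖σ‖, ‖μ₁‖, ‖μ₂‖, ‖μ₃‖] := by
    refine hperm.eq_of_pairwise' (r := (· ≤ ·)) ?_ ?_
    · simp only [List.pairwise_cons, List.mem_cons, List.not_mem_nil, or_false,
        forall_eq_or_imp, forall_eq]
      exact ⟨⟨hc.le, hab ▸ hc.le, (hc.trans hd).le⟩, ⟨hab.le, hd.le⟩, hab ▸ hd.le, by simp⟩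
    · simp only [List.pairwise_cons, List.mem_cons, List.not_mem_nil, or_false,
        forall_eq_or_imp, forall_eq]
      exact ⟨⟨h1, h1.trans h2, (h1.trans h2).trans h3⟩, ⟨h2, h2.trans h3⟩, h3, by simp⟩
  simp only [List.cons.injEq, and_true] at heq
  obtain ⟨-, e1, e2, -⟩ := heq
  have key : ∀ μ ∈ ({a, b, c, d} : Multiset ℂ), ‖μ‖ = ‖a‖ → μ = a ∨ μ = b := by
    intro μ hμ hn
    simp only [Multiset.insert_eq_cons, Multiset.mem_cons, Multiset.mem_singleton] at hμ
    rcases hμ with rfl | rfl | rfl | rfl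
    · exact Or.inl rfl
    · exact Or.inr rfl
    · exact absurd hn hc.ne
    · exact absurd hn hd.ne'
  exact ⟨key _ (by rw [h]; simp) e1.symm, key _ (by rw [h]; simp) (e2.symm.trans hab.symm)⟩

/-! ### Convergence of orbits -/

theorem tendsto_of_abs_sub_le {y : ℕ → R4} {P : R4} {K : ℝ}
    (h : ∀ n j, |y n j - P j| ≤ K * (1 / 2) ^ n) : Tendsto y atTop (𝓝 P) := by
  have h1 : Tendsto (fun n => WithLp.ofLp (y n)) atTop (𝓝 (WithLp.ofLp P)) := by
    refine tendsto_pi_nhds.2 fun j => ?_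
    rw [tendsto_iff_dist_tendsto_zero]
    refine squeeze_zero (fun _ => dist_nonneg) (fun n => h n j) ?_
    simpa using (tendsto_pow_atTop_nhds_zero_of_lt_one (r := (1 / 2 : ℝ)) (by norm_num)
      (by norm_num)).const_mul K
  exact ((PiLp.continuous_toLp 2 _).tendsto _).comp h1

/-- If `g` contracts coordinatewise towards `P` on an invariant set, its orbits converge
to `P`. -/
theorem tendsto_iterate_of_contracting {g : R4 → R4} {P : R4} {S : Set R4}
    (h : ∀ x ∈ S, g x ∈ S ∧ ∀ t, (∀ j, |x j - P j| ≤ t) → ∀ j, |g x j - P j| ≤ t / 2)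
    {x : R4} (hx : x ∈ S) : Tendsto (fun n => g^[n] x) atTop (𝓝 P) := by
  have hS : ∀ n, g^[n] x ∈ S := fun n => by
    induction n with
    | zero => exact hx
    | succ n ih => rw [Function.iterate_succ_apply']; exact (h _ ih).1
  obtain ⟨K, hK⟩ : ∃ K : ℝ, ∀ j, |x j - P j| ≤ K :=
    ⟨∑ j, |x j - P j|, fun j => Finset.single_le_sum (f := fun j => |x j - P j|)
      (fun _ _ => abs_nonneg _) (Finset.mem_univ j)⟩
  refine tendsto_of_abs_sub_le (K := K) fun n => ?_
  induction n with
  | zero => simpa using hK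
  | succ n ih =>
    rw [Function.iterate_succ_apply']
    intro j
    rw [pow_succ]
    have := (h _ (hS n)).2 _ ih j
    linarith

/-! ### The two fixed points -/

/-- The fixed point of index two. -/
noncomputable def spiralPt : R4 := !₂[0, 0, -1 / 2, 0]

/-- The fixed point of index three. -/
noncomputable def saddlePt : R4 :=
  !₂[3 - 3 / (1 + 512 ^ 2), -(3 * 512) / (1 + 512 ^ 2), 1 / 2, 0]

theorem mem_outerTrap_vec {a b c d : ℝ} (h0 : |a| ≤ 12) (h1 : |b| ≤ 12) (h2 : |c| ≤ 3)
    (h3 : |d| ≤ 2) : (!₂[a, b, c, d] : R4) ∈ outerTrap := ⟨⟨h0, h1⟩, h2, h3⟩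

theorem spiralPt_mem : spiralPt ∈ outerTrap ∧ spiralPt ∈ strips := by
  refine ⟨mem_outerTrap_vec ?_ ?_ ?_ ?_, ?_, Or.inl ?_⟩
  all_goals first | (change |(0 : ℝ)| < _; norm_num) | norm_num [abs_le]

theorem saddlePt_mem : saddlePt ∈ outerTrap ∧ saddlePt ∈ strips := by
  refine ⟨mem_outerTrap_vec ?_ ?_ ?_ ?_, ?_, Or.inr ?_⟩
  · norm_num [abs_le]
  · norm_num [abs_le]
  · norm_num [abs_le]
  · norm_num [abs_le]
  · change |-(3 * 512) / (1 + 512 ^ 2 : ℝ)| < 1 / 128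
    norm_num [abs_lt]
  · change |3 - 3 / (1 + 512 ^ 2 : ℝ) - 3| < 1 / 128
    norm_num [abs_lt]

section Dynamics

variable {f : DiffR4}

theorem diffeo_left (hf : ∀ x, ‖x‖ ≤ 100 → f x = model x) {a b c d : ℝ} (h0 : |a| ≤ 1 / 128)
    (h1 : |b| ≤ 1 / 128) (h2 : |c| ≤ 3) (h3 : |d| ≤ 2) : f !₂[a, b, c, d] =
      !₂[-(512 * b), 512 * a, -1 / 2 + d / 16, d / 16 - (c + 1 / 2) / 16] := by
  rw [hf _ ((norm_le_of_mem_outerTrap (mem_outerTrap_vec (by linarith) (by linarith) h2 h3)).trans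
    (by norm_num))]
  exact model_left h0 h1 (show |d| ≤ 3 by linarith)

theorem diffeo_right (hf : ∀ x, ‖x‖ ≤ 100 → f x = model x) {a b c d : ℝ}
    (h0 : |a - 3| ≤ 1 / 128) (h1 : |b| ≤ 1 / 128) (h2 : |c| ≤ 3) (h3 : |d| ≤ 2) :
    f !₂[a, b, c, d] = !₂[-(512 * b), 512 * (a - 3), 1 / 2 + (c - 1 / 2) / 16,
      d / 16 + Real.arctan (1024 * d)] := by
  have ha := abs_le.1 h0
  rw [hf _ ((norm_le_of_mem_outerTrap (mem_outerTrap_vec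
    (abs_le.2 ⟨by linarith, by linarith⟩) (by linarith) h2 h3)).trans (by norm_num))]
  exact model_right h0 h1 (show |c| ≤ 7 / 2 by linarith)

/-- The size 4 is `512 / 128`: the closed linear zone stretches exactly over this square. -/
theorem diffeo_symm_left (hf : ∀ x, ‖x‖ ≤ 100 → f x = model x) {a b : ℝ} (h0 : |a| ≤ 4)
    (h1 : |b| ≤ 4) : f.symm !₂[a, b, -1 / 2, 0] = !₂[b / 512, -(a / 512), -1 / 2, 0] := by
  have ha := abs_le.1 h0
  have hb := abs_le.1 h1
  refine f.toEquiv.symm_apply_eq.2 (Eq.trans ?_ (diffeo_left hf (abs_le.2 ⟨by linarith, by linarith⟩)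
    (abs_le.2 ⟨by linarith, by linarith⟩) (by norm_num [abs_le]) (by norm_num)).symm)
  ext j
  fin_cases j <;> simp <;> ring

theorem diffeo_symm_right (hf : ∀ x, ‖x‖ ≤ 100 → f x = model x) {a b : ℝ} (h0 : |a| ≤ 4)
    (h1 : |b| ≤ 4) : f.symm !₂[a, b, 1 / 2, 0] = !₂[3 + b / 512, -(a / 512), 1 / 2, 0] := by
  have ha := abs_le.1 h0
  have hb := abs_le.1 h1
  refine f.toEquiv.symm_apply_eq.2 (Eq.trans ?_ (diffeo_right hf (abs_le.2 ⟨by linarith, by linarith⟩)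
    (abs_le.2 ⟨by linarith, by linarith⟩) (by norm_num [abs_le]) (by norm_num)).symm)
  ext j
  fin_cases j <;> simp <;> ring

theorem diffeo_spiralPt (hf : ∀ x, ‖x‖ ≤ 100 → f x = model x) : f spiralPt = spiralPt := by
  rw [spiralPt, diffeo_left hf (by norm_num) (by norm_num) (by norm_num [abs_le]) (by norm_num)]
  norm_num

theorem diffeo_saddlePt (hf : ∀ x, ‖x‖ ≤ 100 → f x = model x) : f saddlePt = saddlePt := by
  rw [saddlePt, diffeo_right hf (by norm_num [abs_le]) (by norm_num [abs_le])
    (by norm_num [abs_le]) (by norm_num)]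
  norm_num

/-! ### Pieces of the invariant manifolds and the heterodimensional cycle -/

theorem mem_stableManifold_spiralPt (hf : ∀ x, ‖x‖ ≤ 100 → f x = model x) {c d : ℝ}
    (hc : |c + 1 / 2| ≤ 1) (hd : |d| ≤ 1) : !₂[0, 0, c, d] ∈ stableManifold f spiralPt := by
  refine tendsto_iterate_of_contracting
    (S := {x | ∃ c d : ℝ, |c + 1 / 2| ≤ 1 ∧ |d| ≤ 1 ∧ x = !₂[0, 0, c, d]}) ?_ ⟨c, d, hc, hd, rfl⟩
  rintro _ ⟨c, d, hc, hd, rfl⟩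
  have hc' := abs_le.1 hc
  have hd' := abs_le.1 hd
  rw [diffeo_left hf (by norm_num) (by norm_num) (abs_le.2 ⟨by linarith, by linarith⟩)
    (by linarith), mul_zero, neg_zero]
  refine ⟨⟨_, _, ?_, ?_, rfl⟩, fun t ht j => ?_⟩
  · exact abs_le.2 ⟨by linarith, by linarith⟩
  · exact abs_le.2 ⟨by linarith, by linarith⟩
  · have h0 : |(0 : ℝ) - 0| ≤ t := ht 0
    have h2 := abs_le.1 (show |c - -1 / 2| ≤ t from ht 2)
    have h3 := abs_le.1 (show |d - 0| ≤ t from ht 3)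
    rw [sub_self, abs_zero] at h0
    fin_cases j
    · change |(0 : ℝ) - 0| ≤ t / 2
      rw [sub_self, abs_zero]; linarith
    · change |(0 : ℝ) - 0| ≤ t / 2
      rw [sub_self, abs_zero]; linarith
    · change |-1 / 2 + d / 16 - -1 / 2| ≤ t / 2
      exact abs_le.2 ⟨by linarith, by linarith⟩
    · change |d / 16 - (c + 1 / 2) / 16 - 0| ≤ t / 2
      exact abs_le.2 ⟨by linarith, by linarith⟩

/-- The fibre through `saddlePt` is invariant and contracted by `1/16`; its radius 1 just reaches
the level `-1/2` of the unstable square of `spiralPt`. -/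
theorem mem_stableManifold_saddlePt (hf : ∀ x, ‖x‖ ≤ 100 → f x = model x) {c : ℝ}
    (hc : |c - 1 / 2| ≤ 1) : !₂[3 - 3 / (1 + 512 ^ 2), -(3 * 512) / (1 + 512 ^ 2), c, 0] ∈
      stableManifold f saddlePt := by
  refine tendsto_iterate_of_contracting (S := {x | ∃ c : ℝ, |c - 1 / 2| ≤ 1 ∧
    x = !₂[3 - 3 / (1 + 512 ^ 2), -(3 * 512) / (1 + 512 ^ 2), c, 0]}) ?_ ⟨c, hc, rfl⟩
  rintro _ ⟨c, hc, rfl⟩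
  have hc' := abs_le.1 hc
  have hfc : f !₂[3 - 3 / (1 + 512 ^ 2), -(3 * 512) / (1 + 512 ^ 2), c, 0] =
      !₂[3 - 3 / (1 + 512 ^ 2), -(3 * 512) / (1 + 512 ^ 2), 1 / 2 + (c - 1 / 2) / 16, 0] := by
    rw [diffeo_right hf (by norm_num [abs_le]) (by norm_num [abs_le])
      (abs_le.2 ⟨by linarith, by linarith⟩) (by norm_num)]
    norm_num
  rw [hfc]
  refine ⟨⟨_, ?_, rfl⟩, fun t ht j => ?_⟩
  · exact abs_le.2 ⟨by linarith, by linarith⟩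
  · have h2 := abs_le.1 (show |c - 1 / 2| ≤ t from ht 2)
    have h0 : |(0 : ℝ) - 0| ≤ t := ht 3
    rw [sub_self, abs_zero] at h0
    fin_cases j
    · change |(3 - 3 / (1 + 512 ^ 2) : ℝ) - (3 - 3 / (1 + 512 ^ 2))| ≤ t / 2
      rw [sub_self, abs_zero]; linarith
    · change |(-(3 * 512) / (1 + 512 ^ 2) : ℝ) - -(3 * 512) / (1 + 512 ^ 2)| ≤ t / 2
      rw [sub_self, abs_zero]; linarith
    · change |1 / 2 + (c - 1 / 2) / 16 - 1 / 2| ≤ t / 2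
      exact abs_le.2 ⟨by linarith, by linarith⟩
    · change |(0 : ℝ) - 0| ≤ t / 2
      rw [sub_self, abs_zero]; linarith

theorem mem_unstableManifold_spiralPt (hf : ∀ x, ‖x‖ ≤ 100 → f x = model x) {a b : ℝ}
    (ha : |a| ≤ 4) (hb : |b| ≤ 4) : !₂[a, b, -1 / 2, 0] ∈ unstableManifold f spiralPt := by
  refine tendsto_iterate_of_contracting (S := {x | ∃ a b : ℝ, |a| ≤ 4 ∧ |b| ≤ 4 ∧
    x = !₂[a, b, -1 / 2, 0]}) ?_ ⟨a, b, ha, hb, rfl⟩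
  rintro _ ⟨a, b, ha, hb, rfl⟩
  have ha' := abs_le.1 ha
  have hb' := abs_le.1 hb
  rw [diffeo_symm_left hf ha hb]
  refine ⟨⟨_, _, ?_, ?_, rfl⟩, fun t ht j => ?_⟩
  · exact abs_le.2 ⟨by linarith, by linarith⟩
  · exact abs_le.2 ⟨by linarith, by linarith⟩
  · have h0 := abs_le.1 (show |a - 0| ≤ t from ht 0)
    have h1 := abs_le.1 (show |b - 0| ≤ t from ht 1)
    fin_cases j
    · change |b / 512 - 0| ≤ t / 2
      exact abs_le.2 ⟨by linarith, by linarith⟩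
    · change |-(a / 512) - 0| ≤ t / 2
      exact abs_le.2 ⟨by linarith, by linarith⟩
    · change |(-1 / 2 : ℝ) - -1 / 2| ≤ t / 2
      exact abs_le.2 ⟨by linarith, by linarith⟩
    · change |(0 : ℝ) - 0| ≤ t / 2
      exact abs_le.2 ⟨by linarith, by linarith⟩

/-- The inverse contracts the square by 512 and keeps it inside itself, since `3 + 4 / 512 ≤ 4`. -/
theorem mem_unstableManifold_saddlePt (hf : ∀ x, ‖x‖ ≤ 100 → f x = model x) {a b : ℝ}
    (ha : |a| ≤ 4) (hb : |b| ≤ 4) : !₂[a, b, 1 / 2, 0] ∈ unstableManifold f saddlePt := by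
  refine tendsto_iterate_of_contracting (S := {x | ∃ a b : ℝ, |a| ≤ 4 ∧ |b| ≤ 4 ∧
    x = !₂[a, b, 1 / 2, 0]}) ?_ ⟨a, b, ha, hb, rfl⟩
  rintro _ ⟨a, b, ha, hb, rfl⟩
  have ha' := abs_le.1 ha
  have hb' := abs_le.1 hb
  rw [diffeo_symm_right hf ha hb]
  refine ⟨⟨_, _, ?_, ?_, rfl⟩, fun t ht j => ?_⟩
  · exact abs_le.2 ⟨by linarith, by linarith⟩
  · exact abs_le.2 ⟨by linarith, by linarith⟩
  · have h0 := abs_le.1 (show |a - (3 - 3 / (1 + 512 ^ 2))| ≤ t from ht 0)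
    have h1 := abs_le.1 (show |b - -(3 * 512) / (1 + 512 ^ 2)| ≤ t from ht 1)
    fin_cases j
    · change |3 + b / 512 - (3 - 3 / (1 + 512 ^ 2))| ≤ t / 2
      exact abs_le.2 ⟨by linarith, by linarith⟩
    · change |-(a / 512) - -(3 * 512) / (1 + 512 ^ 2)| ≤ t / 2
      exact abs_le.2 ⟨by linarith, by linarith⟩
    · change |(1 / 2 : ℝ) - 1 / 2| ≤ t / 2
      exact abs_le.2 ⟨by linarith, by linarith⟩
    · change |(0 : ℝ) - 0| ≤ t / 2
      exact abs_le.2 ⟨by linarith, by linarith⟩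

theorem stableManifold_spiralPt_inter (hf : ∀ x, ‖x‖ ≤ 100 → f x = model x) :
    (stableManifold f spiralPt ∩ unstableManifold f saddlePt).Nonempty :=
  ⟨!₂[0, 0, 1 / 2, 0], mem_stableManifold_spiralPt hf (by norm_num) (by norm_num),
    mem_unstableManifold_saddlePt hf (by norm_num) (by norm_num)⟩

theorem mem_stableManifold_of_apply_mem {P x : R4} (h : f x ∈ stableManifold f P) :
    x ∈ stableManifold f P := by
  refine (tendsto_add_atTop_iff_nat 1).1 ?_
  simpa only [Function.iterate_succ_apply, stableManifold, Set.mem_ofPred_eq] using h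

theorem stableManifold_saddlePt_inter (hf : ∀ x, ‖x‖ ≤ 100 → f x = model x) :
    (stableManifold f saddlePt ∩ unstableManifold f spiralPt).Nonempty := by
  -- The witness is `saddlePt` moved to the level `x 2 = -1/2`; its second coordinate is written
  -- through the fixed point equation `x 0 = -512 * x 1`.
  refine ⟨!₂[3 - 3 / (1 + 512 ^ 2), -((3 - 3 / (1 + 512 ^ 2)) / 512), -1 / 2, 0],
    mem_stableManifold_of_apply_mem ?_,
    mem_unstableManifold_spiralPt hf (by norm_num [abs_le]) (by norm_num [abs_le])⟩
  rw [diffeo_right hf (by norm_num [abs_le]) (by norm_num [abs_le]) (by norm_num [abs_le])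
    (by norm_num)]
  convert mem_stableManifold_saddlePt hf (c := 1 / 2 + (-1 / 2 - 1 / 2) / 16)
    (by norm_num [abs_le]) using 2
  norm_num

/-! ### Eigenvalues at the fixed points -/

theorem eventuallyEq_model (hf : ∀ x, ‖x‖ ≤ 100 → f x = model x) {x : R4} (hx : x ∈ outerTrap) :
    f =ᶠ[𝓝 x] model := by
  filter_upwards [continuous_norm.continuousAt.eventually_lt (continuousAt_const (y := (100 : ℝ)))
    ((norm_le_of_mem_outerTrap hx).trans_lt (by norm_num))] with y hy
  exact hf y hy.le

theorem eigenvalues_spiralPt (hf : ∀ x, ‖x‖ ≤ 100 → f x = model x) : eigenvalues f spiralPt =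
    {((512 : ℝ) : ℂ) * Complex.I, -(((512 : ℝ) : ℂ) * Complex.I), ⟨1 / 32, √3 / 32⟩,
      ⟨1 / 32, -(√3 / 32)⟩} := by
  refine eigenvalues_of_hasFDerivAt ((hasFDerivAt_model_left ?_ ?_ ?_).congr_of_eventuallyEq
    (eventuallyEq_model hf spiralPt_mem.1)) ?_ ?_
  · simp [spiralPt]
  · simp [spiralPt]
  · simp [spiralPt]
  · apply Complex.ext <;> simp
    norm_num
  · have h3 : √3 * √3 = 3 := Real.mul_self_sqrt (by norm_num)
    apply Complex.ext
    · rw [Complex.mul_re, Complex.ofReal_re]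
      linear_combination (1 / 1024 : ℝ) * h3
    · rw [Complex.mul_im, Complex.ofReal_im]
      ring

theorem eigenvalues_saddlePt (hf : ∀ x, ‖x‖ ≤ 100 → f x = model x) : eigenvalues f saddlePt =
    {((512 : ℝ) : ℂ) * Complex.I, -(((512 : ℝ) : ℂ) * Complex.I), ((1 / 16 : ℝ) : ℂ),
      ((1 / 16 + 1024 : ℝ) : ℂ)} := by
  have h := (hasFDerivAt_model_right (x := saddlePt) ?_ saddlePt_mem.2.1
    saddlePt_mem.1.2.1).congr_of_eventuallyEq (eventuallyEq_model hf saddlePt_mem.1)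
  · refine eigenvalues_of_hasFDerivAt h ?_ ?_
    · rw [← Complex.ofReal_add]
      congr 1
      simp [saddlePt]
    · rw [← Complex.ofReal_mul]
      congr 1
      simp [saddlePt]
  · change |3 - 3 / (1 + 512 ^ 2 : ℝ) - 3| < 1 / 128
    norm_num [abs_lt]

theorem norm_lt_one_of_re_im {z : ℂ} (h : |z.re| + |z.im| < 1) : ‖z‖ < 1 :=
  (Complex.norm_le_abs_re_add_abs_im z).trans_lt h

theorem norm_spiral_lt_one : ‖(⟨1 / 32, √3 / 32⟩ : ℂ)‖ < 1 ∧
    ‖(⟨1 / 32, -(√3 / 32)⟩ : ℂ)‖ < 1 := by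
  have h3 : √3 ≤ 2 := Real.sqrt_le_iff.2 ⟨by norm_num, by norm_num⟩
  have h0 : |√3 / 32| = √3 / 32 := abs_of_nonneg (by positivity)
  constructor <;> refine norm_lt_one_of_re_im ?_
  · change |(1 / 32 : ℝ)| + |√3 / 32| < 1
    rw [h0, abs_of_pos (by norm_num)]; linarith
  · change |(1 / 32 : ℝ)| + |-(√3 / 32)| < 1
    rw [abs_neg, h0, abs_of_pos (by norm_num)]; linarith

theorem norm_rotation : ‖((512 : ℝ) : ℂ) * Complex.I‖ = 512 ∧
    ‖-(((512 : ℝ) : ℂ) * Complex.I)‖ = 512 := by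
  rw [norm_neg, norm_mul, Complex.norm_I, mul_one, Complex.norm_real]
  norm_num

theorem norm_saddle : ‖((1 / 16 : ℝ) : ℂ)‖ = 1 / 16 ∧
    ‖((1 / 16 + 1024 : ℝ) : ℂ)‖ = 1 / 16 + 1024 := by
  rw [Complex.norm_real, Complex.norm_real]
  norm_num

theorem isHyperbolicFixedPoint_spiralPt (hf : ∀ x, ‖x‖ ≤ 100 → f x = model x) :
    IsHyperbolicFixedPoint f spiralPt := by
  refine ⟨diffeo_spiralPt hf, ?_⟩
  rw [eigenvalues_spiralPt hf]
  intro μ hμ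
  simp only [Multiset.insert_eq_cons, Multiset.mem_cons, Multiset.mem_singleton] at hμ
  rcases hμ with rfl | rfl | rfl | rfl
  · rw [norm_rotation.1]; norm_num
  · rw [norm_rotation.2]; norm_num
  · exact norm_spiral_lt_one.1.ne
  · exact norm_spiral_lt_one.2.ne

theorem isHyperbolicFixedPoint_saddlePt (hf : ∀ x, ‖x‖ ≤ 100 → f x = model x) :
    IsHyperbolicFixedPoint f saddlePt := by
  refine ⟨diffeo_saddlePt hf, ?_⟩
  rw [eigenvalues_saddlePt hf]
  intro μ hμ
  simp only [Multiset.insert_eq_cons, Multiset.mem_cons, Multiset.mem_singleton] at hμ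
  rcases hμ with rfl | rfl | rfl | rfl
  · rw [norm_rotation.1]; norm_num
  · rw [norm_rotation.2]; norm_num
  · rw [norm_saddle.1]; norm_num
  · rw [norm_saddle.2]; norm_num

theorem index_spiralPt (hf : ∀ x, ‖x‖ ≤ 100 → f x = model x) : index f spiralPt = 2 := by
  rw [index_of_eigenvalues (eigenvalues_spiralPt hf), norm_rotation.1, norm_rotation.2,
    if_neg norm_spiral_lt_one.1.not_gt, if_neg norm_spiral_lt_one.2.not_gt]
  norm_num

theorem index_saddlePt (hf : ∀ x, ‖x‖ ≤ 100 → f x = model x) : index f saddlePt = 3 := by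
  rw [index_of_eigenvalues (eigenvalues_saddlePt hf), norm_rotation.1, norm_rotation.2,
    norm_saddle.1, norm_saddle.2]
  norm_num

theorem im_rotation_ne_zero {μ : ℂ} (h : μ = ((512 : ℝ) : ℂ) * Complex.I ∨
    μ = -(((512 : ℝ) : ℂ) * Complex.I)) : μ.im ≠ 0 := by
  rcases h with rfl | rfl <;> simp

theorem im_eigenvalues_spiralPt (hf : ∀ x, ‖x‖ ≤ 100 → f x = model x) :
    ∀ μ ∈ eigenvalues f spiralPt, μ.im ≠ 0 := by
  rw [eigenvalues_spiralPt hf]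
  intro μ hμ
  have h3 : 0 < √3 / 32 := by positivity
  simp only [Multiset.insert_eq_cons, Multiset.mem_cons, Multiset.mem_singleton] at hμ
  rcases hμ with h | h | rfl | rfl
  · exact im_rotation_ne_zero (Or.inl h)
  · exact im_rotation_ne_zero (Or.inr h)
  · exact h3.ne'
  · exact neg_ne_zero.2 h3.ne'

theorem im_middle_eigenvalues_saddlePt (hf : ∀ x, ‖x‖ ≤ 100 → f x = model x)
    {σ μ₁ μ₂ μ₃ : ℂ} (h : eigenvalues f saddlePt = {σ, μ₁, μ₂, μ₃}) (h1 : ‖σ‖ ≤ ‖μ₁‖)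
    (h2 : ‖μ₁‖ ≤ ‖μ₂‖) (h3 : ‖μ₂‖ ≤ ‖μ₃‖) : μ₁.im ≠ 0 ∧ μ₂.im ≠ 0 := by
  rw [eigenvalues_saddlePt hf] at h
  have := middle_eigenvalues h (norm_rotation.1.trans norm_rotation.2.symm)
    (by rw [norm_rotation.1, norm_saddle.1]; norm_num)
    (by rw [norm_rotation.1, norm_saddle.2]; norm_num) h1 h2 h3
  exact ⟨im_rotation_ne_zero this.1, im_rotation_ne_zero this.2⟩

end Dynamics

end CycleDyn

open CycleDyn

theorem proposition2 :
    ∃ f : DiffR4,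
      IsCompact (CycleDyn.support f) ∧
      ∃ A B : Set R4, IsCompact A ∧ IsCompact B ∧ B ⊆ A ∧
        f '' A ⊆ interior A ∧ f '' B ⊆ interior B ∧
        ∃ P ∈ A \ B, ∃ Q ∈ A \ B,
          IsHyperbolicFixedPoint f P ∧ IsHyperbolicFixedPoint f Q ∧
          HasHeterodimensionalCycle f P Q ∧
          (CycleDyn.index f P = 3 ∧
            -- every listing of the four eigenvalues in non-decreasing order of their moduli
            ∀ σ μ₁ μ₂ μ₃ : ℂ, CycleDyn.eigenvalues f P = {σ, μ₁, μ₂, μ₃} →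
              ‖σ‖ ≤ ‖μ₁‖ → ‖μ₁‖ ≤ ‖μ₂‖ → ‖μ₂‖ ≤ ‖μ₃‖ → μ₁.im ≠ 0 ∧ μ₂.im ≠ 0) ∧
          (CycleDyn.index f Q = 2 ∧ ∀ μ ∈ CycleDyn.eigenvalues f Q, μ.im ≠ 0) ∧
          ∃ K : ℝ, 1 < K ∧ ∀ x ∈ A \ B, K < minNorm (exteriorCubeDeriv f x) := by
  -- Any radius above 20 contains a neighbourhood of `outerTrap`, so there `f` and `model` share
  -- values and derivatives.
  obtain ⟨f, hsupp, hf⟩ := realizable_model 100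
  have hout : ∀ {x}, x ∈ outerTrap → f x = model x := fun hx =>
    hf _ ((norm_le_of_mem_outerTrap hx).trans (by norm_num))
  have hP := isHyperbolicFixedPoint_saddlePt hf
  have hQ := isHyperbolicFixedPoint_spiralPt hf
  have iP := index_saddlePt hf
  have iQ := index_spiralPt hf
  refine ⟨f, hsupp, outerTrap, innerTrap, isCompact_outerTrap, isCompact_innerTrap,
    Set.sdiff_subset, ?_, ?_, saddlePt, mem_outerTrap_diff_innerTrap.2 saddlePt_mem, spiralPt,
    mem_outerTrap_diff_innerTrap.2 spiralPt_mem, hP, hQ,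
    ⟨hP, hQ, by rw [iP, iQ]; norm_num, stableManifold_saddlePt_inter hf,
      stableManifold_spiralPt_inter hf⟩,
    ⟨iP, fun σ μ₁ μ₂ μ₃ => im_middle_eigenvalues_saddlePt hf⟩,
    ⟨iQ, im_eigenvalues_spiralPt hf⟩, 3 / 2, by norm_num, fun x hx => ?_⟩
  · rintro _ ⟨x, hx, rfl⟩
    rw [hout hx]
    exact model_image_outerTrap hx
  · rintro _ ⟨x, hx, rfl⟩
    rw [hout hx.1]
    exact model_image_innerTrap hx
  · obtain ⟨hxo, hxs⟩ := mem_outerTrap_diff_innerTrap.1 hx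
    -- The lower bound 2 is not strict, hence the choice of `3 / 2` between 1 and 2.
    exact lt_of_lt_of_le (by norm_num) (two_le_minNorm (eventuallyEq_model hf hxo) hxo hxs)
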